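/- **Proposition 2.1.** All algebras are over $\mathbb{Q}$. A CDGA $(A,d_A)$ is a graded-commutative algebra $A=\bigoplus_{n\ge 0}A^n$ with a differential of degree $+1$ that is a graded derivation; morphisms preserve degrees, units, products and differentials; a quasi-isomorphism is a morphism that induces an isomorphism in cohomology, and two CDGAs are quasi-isomorphic if they are connected by a finite zigzag of quasi-isomorphisms. A Sullivan algebra is a CDGA $(\bigwedge V,d)$, where $\bigwedge V$ is the free graded-commutative algebra on a graded vector space $V=\bigoplus_{n\ge 1}V^n$, such that $V=\bigcup_{k\ge 0}V(k)$ for graded subspaces $V(0)\subset V(1)\subset\cdots$ with $d=0$ on $V(0)$ and $d(V(k))\subset\bigwedge V(k-1)$ for $k\ge 1$; it is minimal if $dV\subset\bigwedge^+V\cdot\bigwedge^+V$. A minimal Sullivan model of $(A,d_A)$ is a quasi-isomorphism $(\bigwedge V,d)\to(A,d_A)$ with $(\bigwedge V,d)$ a minimal Sullivan algebra. The CDGA $(A,d_A)$ is formal if it has a minimal Sullivan model $(\bigwedge V,d)$ that is quasi-isomorphic to $(H^*(A,d_A),0)$. Let $(A,d_A)$ and $(B,d_B)$ be CDGAs with $H^0(A)=\mathbb{Q}=H^0(B)$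 and $H^1(A)=0$, and suppose that there are CDGA morphisms $f\colon(A,d_A)\to(B,d_B)$ and $g\colon(B,d_B)\to(A,d_A)$ with $g\circ f=\mathrm{Id}$. If $(B,d_B)$ is formal, then $(A,d_A)$ is formal. -/

import Mathlib

universe u

/-- A commutative differential graded algebra over `ℚ`, graded in degrees `n ≥ 0`, with a
differential of degree `+1`. The condition `H⁰ = ℚ` is the separate predicate
`CDGA.IsCohomologicallyConnected`. -/
structure CDGA : Type (u + 1) where
  /-- the underlying algebra -/
  carrier : Type u
  [ring : Ring carrier]
  [algebra : Algebra ℚ carrier]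
  /-- the homogeneous components -/
  gr : ℕ → Submodule ℚ carrier
  [graded : GradedAlgebra gr]
  /-- the differential -/
  d : carrier →ₗ[ℚ] carrier
  mul_comm' : ∀ {i j : ℕ} {a b : carrier}, a ∈ gr i → b ∈ gr j →
    a * b = (-1 : ℚ) ^ (i * j) • (b * a)
  d_mem : ∀ {n : ℕ} {a : carrier}, a ∈ gr n → d a ∈ gr (n + 1)
  d_d : ∀ a : carrier, d (d a) = 0
  leibniz : ∀ {n : ℕ} {a : carrier} (b : carrier), a ∈ gr n →
    d (a * b) = d a * b + (-1 : ℚ) ^ n • (a * d b)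

namespace CDGA

attribute [instance] CDGA.ring CDGA.algebra CDGA.graded

/-- Morphisms of CDGAs: unital algebra maps which preserve degrees and commute with the
differentials. -/
@[ext]
structure Hom (A B : CDGA.{u}) where
  toAlgHom : A.carrier →ₐ[ℚ] B.carrier
  map_gr : ∀ {n : ℕ} {a : A.carrier}, a ∈ A.gr n → toAlgHom a ∈ B.gr n
  map_d : ∀ a : A.carrier, toAlgHom (A.d a) = B.d (toAlgHom a)

/-- The identity morphism. -/
def Hom.id (A : CDGA.{u}) : Hom A A where
  toAlgHom := AlgHom.id ℚ A.carrier
  map_gr h := h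
  map_d _ := rfl

/-- Composition of morphisms: `g.comp f` is `g ∘ f`. -/
def Hom.comp {A B C : CDGA.{u}} (g : Hom B C) (f : Hom A B) : Hom A C where
  toAlgHom := g.toAlgHom.comp f.toAlgHom
  map_gr h := g.map_gr (f.map_gr h)
  map_d a := by simp [f.map_d, g.map_d]

section Cohomology

variable (A : CDGA.{u})

theorem exists_sum_proj (a : A.carrier) :
    ∃ s : Finset ℕ, ∑ i ∈ s, GradedAlgebra.proj A.gr i a = a := by
  classical
  exact ⟨(DirectSum.decompose A.gr a).support, by
    simpa using DirectSum.sum_support_decompose A.gr a⟩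

theorem proj_mem (i : ℕ) (a : A.carrier) : GradedAlgebra.proj A.gr i a ∈ A.gr i := by
  simp

theorem proj_same {i : ℕ} {a : A.carrier} (h : a ∈ A.gr i) : GradedAlgebra.proj A.gr i a = a := by
  simpa using DirectSum.decompose_of_mem_same A.gr h

theorem proj_ne {i j : ℕ} {a : A.carrier} (h : a ∈ A.gr i) (hij : i ≠ j) :
    GradedAlgebra.proj A.gr j a = 0 := by
  simpa using DirectSum.decompose_of_mem_ne A.gr h hij

theorem proj_succ_d (n : ℕ) (a : A.carrier) :
    GradedAlgebra.proj A.gr (n + 1) (A.d a) = A.d (GradedAlgebra.proj A.gr n a) := by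
  induction a using DirectSum.Decomposition.inductionOn A.gr with
  | zero => simp
  | @homogeneous i m =>
    by_cases h : i = n
    · subst h
      rw [A.proj_same m.2, A.proj_same (A.d_mem m.2)]
    · rw [A.proj_ne m.2 h, A.proj_ne (A.d_mem m.2) (by omega), map_zero]
  | add a b ha hb => simp only [map_add, ha, hb]

theorem proj_zero_d (a : A.carrier) : GradedAlgebra.proj A.gr 0 (A.d a) = 0 := by
  induction a using DirectSum.Decomposition.inductionOn A.gr with
  | zero => simp
  | @homogeneous i m => rw [A.proj_ne (A.d_mem m.2) (by omega)]
  | add a b ha hb => simp only [map_add, ha, hb, add_zero]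

theorem d_mul_of_d_right (a b : A.carrier) (hb : A.d b = 0) : A.d (a * b) = A.d a * b := by
  obtain ⟨s, hs⟩ := A.exists_sum_proj a
  conv_lhs => rw [← hs]
  conv_rhs => rw [← hs]
  simp only [Finset.sum_mul, map_sum]
  refine Finset.sum_congr rfl fun i _ => ?_
  rw [A.leibniz b (A.proj_mem i a), hb]
  simp

theorem exists_mul_d_of_d_left (a b : A.carrier) (ha : A.d a = 0) :
    ∃ c, a * A.d b = A.d c := by
  have key : ∀ i, GradedAlgebra.proj A.gr i a * A.d b =
      A.d ((-1 : ℚ) ^ i • (GradedAlgebra.proj A.gr i a * b)) := by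
    intro i
    rw [map_smul, A.leibniz b (A.proj_mem i a), ← A.proj_succ_d, ha, map_zero, zero_mul, zero_add,
      smul_smul, ← mul_pow]
    simp
  obtain ⟨s, hs⟩ := A.exists_sum_proj a
  refine ⟨∑ i ∈ s, (-1 : ℚ) ^ i • (GradedAlgebra.proj A.gr i a * b), ?_⟩
  rw [map_sum]
  conv_lhs => rw [← hs]
  rw [Finset.sum_mul]
  exact Finset.sum_congr rfl fun i _ => key i

/-- The subalgebra `ker d` of cocycles. -/
def cocycles : Subalgebra ℚ A.carrier where
  carrier := {a | A.d a = 0}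
  mul_mem' {a b} ha hb := by
    have ha' : A.d a = 0 := ha
    change A.d (a * b) = 0
    rw [A.d_mul_of_d_right a b hb, ha', zero_mul]
  add_mem' {a b} ha hb := by
    have ha' : A.d a = 0 := ha
    have hb' : A.d b = 0 := hb
    change A.d (a + b) = 0
    rw [map_add, ha', hb', add_zero]
  algebraMap_mem' q := by
    have h1 : A.d 1 = 0 := by
      have h := A.leibniz (n := 0) (a := 1) 1 SetLike.GradedOne.one_mem
      simpa using h
    change A.d (algebraMap ℚ A.carrier q) = 0
    rw [Algebra.algebraMap_eq_smul_one, map_smul, h1, smul_zero]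

theorem mem_cocycles {a : A.carrier} : a ∈ A.cocycles ↔ A.d a = 0 := Iff.rfl

/-- The ideal `im d` of coboundaries in the algebra of cocycles. -/
def coboundaries : Ideal A.cocycles where
  carrier := {z | ∃ c : A.carrier, (z : A.carrier) = A.d c}
  add_mem' := by
    rintro x y ⟨a, ha⟩ ⟨b, hb⟩
    exact ⟨a + b, by simp [ha, hb]⟩
  zero_mem' := ⟨0, by simp⟩
  smul_mem' := by
    rintro z x ⟨a, ha⟩
    obtain ⟨c, hc⟩ := A.exists_mul_d_of_d_left z a z.2
    exact ⟨c, by simp [ha, hc]⟩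

theorem mem_coboundaries {z : A.cocycles} :
    z ∈ A.coboundaries ↔ ∃ c : A.carrier, (z : A.carrier) = A.d c := Iff.rfl

instance : A.coboundaries.IsTwoSided where
  mul_mem_of_left := by
    rintro x z ⟨a, ha⟩
    exact ⟨a * z, by rw [A.d_mul_of_d_right a z z.2, ← ha]; rfl⟩

/-- The cohomology algebra `H(A) = ker d / im d`. -/
def CohomologyAlgebra : Type u := A.cocycles ⧸ A.coboundaries

instance : Ring A.CohomologyAlgebra := inferInstanceAs (Ring (A.cocycles ⧸ A.coboundaries))

instance : Algebra ℚ A.CohomologyAlgebra :=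
  inferInstanceAs (Algebra ℚ (A.cocycles ⧸ A.coboundaries))

/-- The class of a cocycle. -/
def toCohomology : A.cocycles →ₐ[ℚ] A.CohomologyAlgebra :=
  Ideal.Quotient.mkₐ ℚ A.coboundaries

theorem toCohomology_surjective : Function.Surjective A.toCohomology :=
  Ideal.Quotient.mkₐ_surjective ℚ A.coboundaries

theorem toCohomology_eq_zero {z : A.cocycles} :
    A.toCohomology z = 0 ↔ ∃ c : A.carrier, (z : A.carrier) = A.d c :=
  Ideal.Quotient.eq_zero_iff_mem

/-- `Hⁿ(A)`: the classes of cocycles of degree `n`. -/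
def cohomologyGr (n : ℕ) : Submodule ℚ A.CohomologyAlgebra :=
  ((A.gr n).comap A.cocycles.val.toLinearMap).map A.toCohomology.toLinearMap

theorem mem_cohomologyGr {n : ℕ} {x : A.CohomologyAlgebra} :
    x ∈ A.cohomologyGr n ↔ ∃ z : A.cocycles, (z : A.carrier) ∈ A.gr n ∧ A.toCohomology z = x :=
  Iff.rfl

/-- Projection of a cocycle to its component of degree `n`. -/
noncomputable def cocyclesProj (n : ℕ) : A.cocycles →+ A.cocycles where
  toFun z := ⟨GradedAlgebra.proj A.gr n z, by
    rw [mem_cocycles, ← A.proj_succ_d, (A.mem_cocycles.1 z.2), map_zero]⟩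
  map_zero' := by ext; simp
  map_add' x y := by ext; simp

/-- Projection of a cohomology class to its component of degree `n`. -/
noncomputable def cohomologyProj (n : ℕ) : A.CohomologyAlgebra →+ A.CohomologyAlgebra :=
  QuotientAddGroup.lift _ ((A.toCohomology : A.cocycles →+ A.CohomologyAlgebra).comp
    (A.cocyclesProj n)) (by
      rintro z ⟨c, hc⟩
      refine A.toCohomology_eq_zero.2 ?_
      cases n with
      | zero => exact ⟨0, by simp [cocyclesProj, -GradedAlgebra.proj_apply, hc, A.proj_zero_d]⟩
      | succ n =>
        exact ⟨GradedAlgebra.proj A.gr n c, by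
          simp [cocyclesProj, -GradedAlgebra.proj_apply, hc, A.proj_succ_d]⟩)

theorem cohomologyProj_toCohomology (n : ℕ) (z : A.cocycles) :
    A.cohomologyProj n (A.toCohomology z) = A.toCohomology (A.cocyclesProj n z) := rfl

theorem cohomologyProj_same {n : ℕ} {x : A.CohomologyAlgebra} (hx : x ∈ A.cohomologyGr n) :
    A.cohomologyProj n x = x := by
  obtain ⟨z, hz, rfl⟩ := hx
  change A.cohomologyProj n (A.toCohomology z) = A.toCohomology z
  rw [cohomologyProj_toCohomology]
  congr 1
  ext
  exact A.proj_same hz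

theorem cohomologyProj_ne {m n : ℕ} {x : A.CohomologyAlgebra} (hx : x ∈ A.cohomologyGr m)
    (h : m ≠ n) : A.cohomologyProj n x = 0 := by
  obtain ⟨z, hz, rfl⟩ := hx
  change A.cohomologyProj n (A.toCohomology z) = 0
  rw [cohomologyProj_toCohomology]
  have : A.cocyclesProj n z = 0 := by
    ext
    exact A.proj_ne hz h
  rw [this, map_zero]

theorem cohomology_isInternal : DirectSum.IsInternal A.cohomologyGr := by
  have hproj : ∀ (x : DirectSum ℕ fun n => A.cohomologyGr n) (n : ℕ),
      A.cohomologyProj n (DirectSum.coeAddMonoidHom A.cohomologyGr x) = x n := by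
    intro x n
    induction x using DirectSum.induction_on with
    | zero => rw [AddMonoidHom.map_zero, AddMonoidHom.map_zero]; rfl
    | of i x =>
      rw [DirectSum.coeAddMonoidHom_of]
      by_cases h : i = n
      · subst h
        rw [A.cohomologyProj_same x.2, DirectSum.of_eq_same]
      · rw [A.cohomologyProj_ne x.2 h, DirectSum.of_eq_of_ne _ _ _ (Ne.symm h)]
        rfl
    | add x y hx hy =>
      rw [AddMonoidHom.map_add, AddMonoidHom.map_add, hx, hy]
      rfl
  constructor
  · intro x y hxy
    refine DFinsupp.ext fun n => Subtype.ext ?_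
    rw [← hproj x n, ← hproj y n, hxy]
  · intro x
    obtain ⟨z, rfl⟩ := A.toCohomology_surjective x
    obtain ⟨s, hs⟩ := A.exists_sum_proj (z : A.carrier)
    refine ⟨∑ i ∈ s, DirectSum.of (fun n => A.cohomologyGr n) i
        ⟨A.toCohomology (A.cocyclesProj i z), ⟨A.cocyclesProj i z, A.proj_mem i z, rfl⟩⟩, ?_⟩
    rw [map_sum]
    simp only [DirectSum.coeAddMonoidHom_of]
    rw [← map_sum]
    congr 1
    ext
    rw [AddSubmonoidClass.coe_finsetSum]
    exact hs

noncomputable instance : GradedAlgebra A.cohomologyGr :=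
  { A.cohomology_isInternal.chooseDecomposition with
    one_mem := ⟨1, SetLike.GradedOne.one_mem (A := A.gr), map_one A.toCohomology⟩
    mul_mem := by
      rintro i j _ _ ⟨a, ha, rfl⟩ ⟨b, hb, rfl⟩
      exact ⟨a * b, SetLike.GradedMul.mul_mem (A := A.gr) ha hb, map_mul A.toCohomology a b⟩ }

/-- The cohomology `(H(A), 0)` as a CDGA with zero differential. -/
noncomputable def cohomology : CDGA.{u} where
  carrier := A.CohomologyAlgebra
  gr := A.cohomologyGr
  d := 0
  mul_comm' := by
    rintro i j _ _ ⟨a, ha, rfl⟩ ⟨b, hb, rfl⟩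
    change A.toCohomology a * A.toCohomology b =
      (-1 : ℚ) ^ (i * j) • (A.toCohomology b * A.toCohomology a)
    rw [← map_mul, ← map_mul, ← map_smul]
    congr 1
    ext
    exact A.mul_comm' ha hb
  d_mem _ := by simp
  d_d _ := rfl
  leibniz _ _ := by simp

/-- `H⁰(A) = ℚ`, i.e. the unit `ℚ → H⁰(A)` is an isomorphism. -/
def IsCohomologicallyConnected : Prop :=
  Function.Injective (algebraMap ℚ A.cohomology.carrier) ∧
    ∀ x ∈ A.cohomology.gr 0, ∃ q : ℚ, algebraMap ℚ A.cohomology.carrier q = x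

end Cohomology

/-- The map on cocycles induced by a morphism. -/
def Hom.cocyclesMap {A B : CDGA.{u}} (f : Hom A B) : A.cocycles →ₐ[ℚ] B.cocycles :=
  (f.toAlgHom.comp A.cocycles.val).codRestrict B.cocycles fun z => by
    have hz : A.d z = 0 := z.2
    rw [mem_cocycles]
    change B.d (f.toAlgHom z) = 0
    rw [← f.map_d, hz, map_zero]

/-- The morphism `H(f) : H(A) → H(B)`, `[z] ↦ [f z]`, induced by `f : A → B`. -/
noncomputable def Hom.cohomologyMap {A B : CDGA.{u}} (f : Hom A B) :
    Hom A.cohomology B.cohomology where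
  toAlgHom := Ideal.Quotient.liftₐ A.coboundaries (B.toCohomology.comp f.cocyclesMap) (by
    rintro z ⟨c, hc⟩
    refine B.toCohomology_eq_zero.2 ⟨f.toAlgHom c, ?_⟩
    change f.toAlgHom z = _
    rw [hc, f.map_d])
  map_gr := by
    rintro n _ ⟨z, hz, rfl⟩
    exact ⟨f.cocyclesMap z, f.map_gr hz, rfl⟩
  map_d _ := map_zero _

theorem Hom.cohomologyMap_toCohomology {A B : CDGA.{u}} (f : Hom A B) (z : A.cocycles) :
    f.cohomologyMap.toAlgHom (A.toCohomology z) = B.toCohomology (f.cocyclesMap z) := rfl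

/-- A quasi-isomorphism is a morphism inducing an isomorphism in cohomology. -/
def Hom.IsQuasiIso {A B : CDGA.{u}} (f : Hom A B) : Prop :=
  Function.Bijective f.cohomologyMap.toAlgHom

/-- Two CDGAs are quasi-isomorphic if they are linked by a finite chain of quasi-isomorphisms
`A → • ← • → ⋯ ← B`, i.e. by the equivalence relation generated by quasi-isomorphisms. -/
def IsQuasiIsomorphic (A B : CDGA.{u}) : Prop :=
  Relation.EqvGen (fun C D : CDGA.{u} => ∃ f : Hom C D, f.IsQuasiIso) A B

/-- The ideal (as a subspace) `A⁺ = ⨁_{n ≥ 1} Aⁿ`. -/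
def positivePart (A : CDGA.{u}) : Submodule ℚ A.carrier := ⨆ n : ℕ, A.gr (n + 1)

/-- The subspace `A⁺ · A⁺` spanned by the products of two elements of `A⁺`. -/
def decomposables (A : CDGA.{u}) : Submodule ℚ A.carrier := A.positivePart * A.positivePart

end CDGA

/-! ### Free graded commutative algebras -/

/-- The relations `x_i x_j = (-1)^{|x_i||x_j|} x_j x_i`. (They give `x_i² = 0` for `|x_i|` odd,
since `2` is invertible.) -/
inductive FreeCGA.Rel {ι : Type u} (deg : ι → ℕ) : FreeAlgebra ℚ ι → FreeAlgebra ℚ ι → Prop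
  | comm (i j : ι) : FreeCGA.Rel deg (FreeAlgebra.ι ℚ i * FreeAlgebra.ι ℚ j)
      ((-1 : ℚ) ^ (deg i * deg j) • (FreeAlgebra.ι ℚ j * FreeAlgebra.ι ℚ i))

/-- The free graded commutative algebra `ΛV` on the graded vector space `V` which has the
basis `x_i`, `i : ι`, with `x_i` of degree `deg i`. -/
def FreeCGA {ι : Type u} (deg : ι → ℕ) : Type u := RingQuot (FreeCGA.Rel deg)

namespace FreeCGA

variable {ι : Type u} (deg : ι → ℕ)

noncomputable instance : Ring (FreeCGA deg) := inferInstanceAs (Ring (RingQuot (Rel deg)))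

noncomputable instance : Algebra ℚ (FreeCGA deg) :=
  inferInstanceAs (Algebra ℚ (RingQuot (Rel deg)))

/-- The quotient map from the free associative algebra. -/
noncomputable def mk : FreeAlgebra ℚ ι →ₐ[ℚ] FreeCGA deg := RingQuot.mkAlgHom ℚ (Rel deg)

theorem mk_surjective : Function.Surjective (mk deg) := RingQuot.mkAlgHom_surjective ℚ (Rel deg)

/-- The generator `x_i`. -/
noncomputable def gen (i : ι) : FreeCGA deg := mk deg (FreeAlgebra.ι ℚ i)

theorem gen_mul_gen (i j : ι) :
    gen deg i * gen deg j = (-1 : ℚ) ^ (deg i * deg j) • (gen deg j * gen deg i) := by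
  have h := RingQuot.mkAlgHom_rel ℚ (Rel.comm (deg := deg) i j)
  change mk deg _ = mk deg _ at h
  simpa [gen] using h

/-- Maps out of the free graded commutative algebra. -/
noncomputable def lift {C : Type*} [Ring C] [Algebra ℚ C] (y : ι → C)
    (hy : ∀ i j, y i * y j = (-1 : ℚ) ^ (deg i * deg j) • (y j * y i)) : FreeCGA deg →ₐ[ℚ] C :=
  RingQuot.liftAlgHom ℚ ⟨FreeAlgebra.lift ℚ y, by
    rintro _ _ ⟨i, j⟩
    simpa using hy i j⟩

theorem lift_gen {C : Type*} [Ring C] [Algebra ℚ C] (y : ι → C)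
    (hy : ∀ i j, y i * y j = (-1 : ℚ) ^ (deg i * deg j) • (y j * y i)) (i : ι) :
    lift deg y hy (gen deg i) = y i := by
  have h := RingQuot.liftAlgHom_mkAlgHom_apply ℚ (s := Rel deg) (FreeAlgebra.lift ℚ y) (by
    rintro _ _ ⟨i, j⟩
    simpa using hy i j) (FreeAlgebra.ι ℚ i)
  rw [FreeAlgebra.lift_ι_apply] at h
  exact h

theorem algHom_ext {C : Type*} [Semiring C] [Algebra ℚ C] {f g : FreeCGA deg →ₐ[ℚ] C}
    (h : ∀ i, f (gen deg i) = g (gen deg i)) : f = g := by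
  have : f.comp (mk deg) = g.comp (mk deg) := by
    ext i
    exact h i
  ext x
  obtain ⟨x, rfl⟩ := mk_surjective deg x
  exact DFunLike.congr_fun this x

/-- The component of degree `n`: the span of the monomials of total degree `n`. -/
noncomputable def gr (n : ℕ) : Submodule ℚ (FreeCGA deg) :=
  Submodule.span ℚ {a | ∃ l : List ι, (l.map deg).sum = n ∧ (l.map (gen deg)).prod = a}

theorem prod_mem_gr (l : List ι) : (l.map (gen deg)).prod ∈ gr deg (l.map deg).sum :=
  Submodule.subset_span ⟨l, rfl, rfl⟩

theorem gen_mem_gr (i : ι) : gen deg i ∈ gr deg (deg i) :=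
  Submodule.subset_span ⟨[i], by simp, by simp⟩

noncomputable instance : SetLike.GradedMonoid (gr deg) where
  one_mem := Submodule.subset_span ⟨[], by simp, by simp⟩
  mul_mem := by
    intro i j a b ha hb
    have h := Submodule.mul_mem_mul ha hb
    rw [gr, gr, Submodule.span_mul_span] at h
    refine Submodule.span_mono ?_ h
    rintro _ ⟨_, ⟨l, hl, rfl⟩, _, ⟨m, hm, rfl⟩, rfl⟩
    exact ⟨l ++ m, by simp [hl, hm], by simp⟩

/-- The algebra map `ΛV → ⨁ₙ (ΛV)ⁿ` splitting an element into its components. -/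
noncomputable def decomposeHom : FreeCGA deg →ₐ[ℚ] DirectSum ℕ fun n => gr deg n :=
  lift deg (fun i => DirectSum.of (fun n => gr deg n) (deg i) ⟨gen deg i, gen_mem_gr deg i⟩) (by
    intro i j
    rw [DirectSum.of_mul_of, DirectSum.of_mul_of, ← DirectSum.lof_eq_of ℚ, ← DirectSum.lof_eq_of ℚ,
      ← map_smul, DirectSum.lof_eq_of, DirectSum.lof_eq_of]
    exact DirectSum.of_eq_of_gradedMonoid_eq
      (Sigma.subtype_ext (add_comm _ _) (gen_mul_gen deg i j)))

theorem decomposeHom_gen (i : ι) : decomposeHom deg (gen deg i) =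
    DirectSum.of (fun n => gr deg n) (deg i) ⟨gen deg i, gen_mem_gr deg i⟩ :=
  lift_gen deg _ _ i

theorem decomposeHom_prod (l : List ι) : decomposeHom deg (l.map (gen deg)).prod =
    DirectSum.of (fun n => gr deg n) (l.map deg).sum ⟨_, prod_mem_gr deg l⟩ := by
  induction l with
  | nil => simp only [List.map_nil, List.prod_nil, map_one]; rfl
  | cons i l ih =>
    simp only [List.map_cons, List.prod_cons, map_mul, ih, decomposeHom_gen]
    rw [DirectSum.of_mul_of]
    exact DirectSum.of_eq_of_gradedMonoid_eq
      (Sigma.subtype_ext (List.sum_cons (a := deg i)).symm (List.prod_cons (a := gen deg i)).symm)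

noncomputable instance : GradedAlgebra (gr deg) :=
  GradedAlgebra.ofAlgHom (gr deg) (decomposeHom deg)
    (by
      refine algHom_ext deg fun i => ?_
      simp [decomposeHom_gen])
    (by
      rintro n ⟨x, hx⟩
      change decomposeHom deg x = _
      induction hx using Submodule.span_induction with
      | mem x h =>
        obtain ⟨l, rfl, rfl⟩ := h
        exact decomposeHom_prod deg l
      | zero =>
        rw [map_zero]
        exact (map_zero (DirectSum.of (fun n => gr deg n) n)).symm
      | add x y hx hy ihx ihy =>
        rw [map_add, ihx, ihy, ← map_add]
        rfl
      | smul q x hx ih =>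
        rw [map_smul, ih, ← DirectSum.lof_eq_of ℚ, ← DirectSum.lof_eq_of ℚ, ← map_smul]
        rfl)

theorem gen_mul_prod (i : ι) (l : List ι) : gen deg i * (l.map (gen deg)).prod =
    (-1 : ℚ) ^ (deg i * (l.map deg).sum) • ((l.map (gen deg)).prod * gen deg i) := by
  induction l with
  | nil => simp
  | cons j l ih =>
    simp only [List.map_cons, List.prod_cons, List.sum_cons]
    rw [← mul_assoc, gen_mul_gen, smul_mul_assoc, mul_assoc, ih, mul_smul_comm, smul_smul,
      mul_assoc, mul_add, pow_add]

theorem prod_mul_prod (l m : List ι) : (l.map (gen deg)).prod * (m.map (gen deg)).prod =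
    (-1 : ℚ) ^ ((l.map deg).sum * (m.map deg).sum) •
      ((m.map (gen deg)).prod * (l.map (gen deg)).prod) := by
  induction l with
  | nil => simp
  | cons i l ih =>
    simp only [List.map_cons, List.prod_cons, List.sum_cons]
    rw [mul_assoc, ih, mul_smul_comm, ← mul_assoc, gen_mul_prod, smul_mul_assoc, smul_smul,
      mul_assoc, add_mul, pow_add, mul_comm ((-1 : ℚ) ^ _)]

theorem graded_comm {i j : ℕ} {a b : FreeCGA deg} (ha : a ∈ gr deg i) (hb : b ∈ gr deg j) :
    a * b = (-1 : ℚ) ^ (i * j) • (b * a) := by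
  induction ha using Submodule.span_induction with
  | zero => simp
  | add x y hx hy ihx ihy => rw [add_mul, mul_add, ihx, ihy, smul_add]
  | smul q x hx ih => rw [smul_mul_assoc, mul_smul_comm, ih, smul_comm]
  | mem x h =>
    obtain ⟨l, rfl, rfl⟩ := h
    induction hb using Submodule.span_induction with
    | zero => simp
    | add x y hx hy ihx ihy => rw [add_mul, mul_add, ihx, ihy, smul_add]
    | smul q x hx ih => rw [smul_mul_assoc, mul_smul_comm, ih, smul_comm]
    | mem x h =>
      obtain ⟨m, rfl, rfl⟩ := h
      exact prod_mul_prod deg l m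

end FreeCGA

/-! ### Sullivan algebras and formality -/

/-- A Sullivan algebra `(ΛV, d)`, where `V = ⨁_{n ≥ 1} Vⁿ` is given by a homogeneous basis.
The nilpotence condition is the usual one: `V` is the union of graded subspaces
`V(0) ⊆ V(1) ⊆ ⋯` with `d V(0) = 0` and `d V(k) ⊆ Λ V(k - 1)`. The basis is adapted to this
filtration (such a basis always exists): `V(k)` is spanned by the generators of level `≤ k`. For
level `0`, the condition below says `d x_i ∈ ℚ`, i.e. `d x_i = 0` for reasons of degree. -/
structure SullivanAlgebra : Type (u + 1) where
  /-- the index set of a homogeneous basis of `V` -/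
  ι : Type u
  /-- the degrees of the basis elements -/
  deg : ι → ℕ
  deg_pos : ∀ i, 1 ≤ deg i
  /-- the differential -/
  d : FreeCGA deg →ₗ[ℚ] FreeCGA deg
  d_mem : ∀ {n : ℕ} {a : FreeCGA deg}, a ∈ FreeCGA.gr deg n → d a ∈ FreeCGA.gr deg (n + 1)
  d_d : ∀ a : FreeCGA deg, d (d a) = 0
  leibniz : ∀ {n : ℕ} {a : FreeCGA deg} (b : FreeCGA deg), a ∈ FreeCGA.gr deg n →
    d (a * b) = d a * b + (-1 : ℚ) ^ n • (a * d b)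
  /-- the filtration -/
  level : ι → ℕ
  nilpotent : ∀ i, d (FreeCGA.gen deg i) ∈
    Algebra.adjoin ℚ (FreeCGA.gen deg '' {j | level j < level i})

namespace SullivanAlgebra

/-- The underlying CDGA of a Sullivan algebra. -/
noncomputable def toCDGA (M : SullivanAlgebra.{u}) : CDGA.{u} where
  carrier := FreeCGA M.deg
  gr := FreeCGA.gr M.deg
  d := M.d
  mul_comm' := FreeCGA.graded_comm M.deg
  d_mem := M.d_mem
  d_d := M.d_d
  leibniz := M.leibniz

/-- A Sullivan algebra is minimal if `d V ⊆ Λ⁺V · Λ⁺V`. -/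
def IsMinimal (M : SullivanAlgebra.{u}) : Prop :=
  ∀ i : M.ι, M.d (FreeCGA.gen M.deg i) ∈ M.toCDGA.decomposables

/-- `M` is a minimal Sullivan model of `A`: it is minimal, and there is a quasi-isomorphism
`M → A`. -/
def IsMinimalModel (M : SullivanAlgebra.{u}) (A : CDGA.{u}) : Prop :=
  M.IsMinimal ∧ ∃ m : CDGA.Hom M.toCDGA A, m.IsQuasiIso

end SullivanAlgebra

/-- `A` is formal if it has a minimal Sullivan model which is quasi-isomorphic to `(H(A), 0)`. -/
def CDGA.IsFormal (A : CDGA.{u}) : Prop :=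
  ∃ M : SullivanAlgebra.{u}, M.IsMinimalModel A ∧ M.toCDGA.IsQuasiIsomorphic A.cohomology

/-! Let m : M → A be a minimal Sullivan model. Formality of B gives a zigzag between B and H(B),
which induces an isomorphism θ : H(B) → H(H(B)) with inverse η. Maps out of a Sullivan algebra can
be carried along a zigzag, so f ∘ m yields ψ : M → H(B) with H(ψ) = θ ∘ H(f ∘ m). Identifying H(B)
with H(H(B)), the composite ρ = H(g) ∘ η ∘ ψ : M → H(A) satisfies H(ρ) = H(g) ∘ η ∘ θ ∘ H(f) ∘ H(m)
= H(m), up to the canonical isomorphism H(A) → H(H(A)). Hence ρ is a quasi-isomorphism and A is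
formal (`CDGA.IsFormal.of_retract`).

Two ingredients carry the argument. The first is `CDGA.Hom.exists_lift`: a map from a Sullivan
algebra to D lifts through a quasi-isomorphism C → D up to a homotopy, built generator by generator
as a map into C times polynomial paths in D. The path ring is modelled inside matrices, of which
only certain elements are meaningful; this is why targets are `HomogeneousDGA`s, whose graded pieces
need not span the ring.

The second is `CDGA.exists_isMinimalModel`: when H⁰(A) = ℚ and H¹(A) = 0, generators of degrees 2,
3, … are added to kill the relative cohomology one degree at a time
(`CDGA.GeneratorSupply.exists_step`). To avoid direct limits of algebras, everything takes place in
one huge free algebra that has a generator for every prescribed differential and image, so that the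
induction only selects subsets of generators. -/

/-- A graded-commutative differential algebra structure for which only homogeneous elements are
required to behave well: the homogeneous parts need not span. -/
structure HomogeneousDGA (R : Type*) [Ring R] [Algebra ℚ R] where
  gr : ℕ → Submodule ℚ R
  one_mem : (1 : R) ∈ gr 0
  mul_mem : ∀ {i j : ℕ} {a b : R}, a ∈ gr i → b ∈ gr j → a * b ∈ gr (i + j)
  mul_comm' : ∀ {i j : ℕ} {a b : R}, a ∈ gr i → b ∈ gr j → a * b = (-1 : ℚ) ^ (i * j) • (b * a)
  d : R →ₗ[ℚ] R
  leibniz : ∀ {m n : ℕ} {a b : R}, a ∈ gr m → b ∈ gr n →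
    d (a * b) = d a * b + (-1 : ℚ) ^ m • (a * d b)

theorem HomogeneousDGA.d_one {R : Type*} [Ring R] [Algebra ℚ R] (E : HomogeneousDGA R) :
    E.d 1 = 0 := by
  simpa using E.leibniz E.one_mem E.one_mem

/-- The homogeneous structure underlying a CDGA. -/
def CDGA.toHomogeneousDGA (A : CDGA.{u}) : HomogeneousDGA A.carrier where
  gr := A.gr
  one_mem := SetLike.GradedOne.one_mem
  mul_mem ha hb := SetLike.GradedMul.mul_mem ha hb
  mul_comm' := A.mul_comm'
  d := A.d
  leibniz ha _ := A.leibniz _ ha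

/-! ### Free graded-commutative algebras: monomials, algebra maps and derivations. -/

namespace FreeCGA

variable {ι : Type u} (deg : ι → ℕ)

theorem adjoin_gen_eq_span (S : Set ι) :
    Subalgebra.toSubmodule (Algebra.adjoin ℚ (gen deg '' S)) =
      Submodule.span ℚ {a | ∃ l : List ι, (∀ i ∈ l, i ∈ S) ∧ (l.map (gen deg)).prod = a} := by
  rw [Algebra.adjoin_eq_span]
  congr 1
  ext a
  constructor
  · intro ha
    induction ha using Submonoid.closure_induction with
    | mem x hx =>
      obtain ⟨i, hi, rfl⟩ := hx
      exact ⟨[i], by simpa using hi, by simp⟩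
    | one => exact ⟨[], by simp, by simp⟩
    | mul x y _ _ hx hy =>
      obtain ⟨l, hl, rfl⟩ := hx
      obtain ⟨m, hm, rfl⟩ := hy
      refine ⟨l ++ m, fun i hi => ?_, by simp⟩
      rcases List.mem_append.1 hi with h | h
      · exact hl i h
      · exact hm i h
  · rintro ⟨l, hl, rfl⟩
    refine Submonoid.list_prod_mem _ fun x hx => ?_
    obtain ⟨i, hi, rfl⟩ := List.mem_map.1 hx
    exact Submonoid.subset_closure ⟨i, hl i hi, rfl⟩

/-- The Leibniz rule needs a homogeneous left factor. Since monomials span the subalgebra, it is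
enough to split off one generator on the left at a time. -/
theorem adjoin_gen_induction {S : Set ι} {p : FreeCGA deg → Prop} (zero : p 0)
    (hadd : ∀ x y, p x → p y → p (x + y)) (hsmul : ∀ (q : ℚ) x, p x → p (q • x)) (one : p 1)
    (cons : ∀ i ∈ S, ∀ l : List ι, (∀ j ∈ l, j ∈ S) → p (l.map (gen deg)).prod →
      p (gen deg i * (l.map (gen deg)).prod))
    {x : FreeCGA deg} (hx : x ∈ Algebra.adjoin ℚ (gen deg '' S)) : p x := by
  rw [← Subalgebra.mem_toSubmodule, adjoin_gen_eq_span] at hx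
  induction hx using Submodule.span_induction with
  | zero => exact zero
  | add x y _ _ hx hy => exact hadd x y hx hy
  | smul q x _ hx => exact hsmul q x hx
  | mem x h =>
    obtain ⟨l, hl, rfl⟩ := h
    induction l with
    | nil => simpa using one
    | cons i l ih =>
      rw [List.map_cons, List.prod_cons]
      exact cons i (hl i (by simp)) l (fun j hj => hl j (by simp [hj]))
        (ih fun j hj => hl j (by simp [hj]))

theorem prod_mem_adjoin {S : Set ι} {l : List ι} (hl : ∀ i ∈ l, i ∈ S) :
    (l.map (gen deg)).prod ∈ Algebra.adjoin ℚ (gen deg '' S) := by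
  rw [← Subalgebra.mem_toSubmodule, adjoin_gen_eq_span]
  exact Submodule.subset_span ⟨l, hl, rfl⟩

theorem gen_mem_adjoin {S : Set ι} {i : ι} (hi : i ∈ S) :
    gen deg i ∈ Algebra.adjoin ℚ (gen deg '' S) :=
  Algebra.subset_adjoin ⟨i, hi, rfl⟩

theorem adjoin_gen_univ : Algebra.adjoin ℚ (gen deg '' Set.univ) = ⊤ := by
  rw [eq_top_iff]
  rintro x -
  obtain ⟨x, rfl⟩ := mk_surjective deg x
  induction x using FreeAlgebra.induction with
  | grade0 q => rw [AlgHom.commutes]; exact Subalgebra.algebraMap_mem _ q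
  | grade1 i => exact gen_mem_adjoin deg (Set.mem_univ i)
  | mul a b ha hb => rw [map_mul]; exact Subalgebra.mul_mem _ ha hb
  | add a b ha hb => rw [map_add]; exact Subalgebra.add_mem _ ha hb

theorem mem_adjoin_univ (x : FreeCGA deg) : x ∈ Algebra.adjoin ℚ (gen deg '' Set.univ) := by
  rw [adjoin_gen_univ]; trivial

theorem proj_mem_span_of_mem_adjoin {S : Set ι} (k : ℕ) {x : FreeCGA deg}
    (hx : x ∈ Algebra.adjoin ℚ (gen deg '' S)) :
    GradedAlgebra.proj (gr deg) k x ∈ Submodule.span ℚ {a | ∃ l : List ι, (∀ i ∈ l, i ∈ S) ∧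
      (l.map deg).sum = k ∧ (l.map (gen deg)).prod = a} := by
  rw [← Subalgebra.mem_toSubmodule, adjoin_gen_eq_span] at hx
  induction hx using Submodule.span_induction with
  | zero => rw [map_zero]; exact Submodule.zero_mem _
  | add x y _ _ hx hy => rw [map_add]; exact Submodule.add_mem _ hx hy
  | smul q x _ hx => rw [map_smul]; exact Submodule.smul_mem _ _ hx
  | mem x h =>
    obtain ⟨l, hl, rfl⟩ := h
    by_cases hk : (l.map deg).sum = k
    · rw [GradedAlgebra.proj_apply,
        DirectSum.decompose_of_mem_same (gr deg) (hk ▸ prod_mem_gr deg l)]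
      exact Submodule.subset_span ⟨l, hl, hk, rfl⟩
    · rw [GradedAlgebra.proj_apply,
        DirectSum.decompose_of_mem_ne (gr deg) (prod_mem_gr deg l) hk]
      exact Submodule.zero_mem _

/-- The projection to degree k keeps or kills each monomial. This reduces all later degree arguments
to counting degrees in a list of generators. -/
theorem mem_span_of_mem_adjoin_of_mem_gr {S : Set ι} {k : ℕ} {x : FreeCGA deg}
    (hx : x ∈ Algebra.adjoin ℚ (gen deg '' S)) (hk : x ∈ gr deg k) :
    x ∈ Submodule.span ℚ {a | ∃ l : List ι, (∀ i ∈ l, i ∈ S) ∧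
      (l.map deg).sum = k ∧ (l.map (gen deg)).prod = a} := by
  have h := proj_mem_span_of_mem_adjoin deg k hx
  rwa [GradedAlgebra.proj_apply, DirectSum.decompose_of_mem_same (gr deg) hk] at h

section Hom

variable {deg} {R : Type*} [Ring R] [Algebra ℚ R]

theorem map_mem_gr (E : HomogeneousDGA R) (φ : FreeCGA deg →ₐ[ℚ] R)
    (hφ : ∀ i, φ (gen deg i) ∈ E.gr (deg i)) {n : ℕ} {a : FreeCGA deg} (ha : a ∈ gr deg n) :
    φ a ∈ E.gr n := by
  induction ha using Submodule.span_induction with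
  | zero => rw [map_zero]; exact Submodule.zero_mem _
  | add x y _ _ hx hy => rw [map_add]; exact Submodule.add_mem _ hx hy
  | smul q x _ hx => rw [map_smul]; exact Submodule.smul_mem _ _ hx
  | mem x h =>
    obtain ⟨l, rfl, rfl⟩ := h
    induction l with
    | nil => simpa using E.one_mem
    | cons i l ih =>
      simp only [List.map_cons, List.prod_cons, List.sum_cons, map_mul]
      exact E.mul_mem (hφ i) ih

/-- Stated for a set S of generators, because in the middle of an inductive construction φ is known
to commute with the differentials only on lower levels. -/
theorem map_d_of_mem_adjoin (E : HomogeneousDGA R) (φ : FreeCGA deg →ₐ[ℚ] R)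
    (hφ : ∀ i, φ (gen deg i) ∈ E.gr (deg i)) (D : FreeCGA deg →ₗ[ℚ] FreeCGA deg)
    (hD : ∀ {n : ℕ} {a : FreeCGA deg} (b : FreeCGA deg), a ∈ gr deg n →
      D (a * b) = D a * b + (-1 : ℚ) ^ n • (a * D b))
    {S : Set ι} (hS : ∀ i ∈ S, φ (D (gen deg i)) = E.d (φ (gen deg i)))
    {x : FreeCGA deg} (hx : x ∈ Algebra.adjoin ℚ (gen deg '' S)) :
    φ (D x) = E.d (φ x) := by
  refine adjoin_gen_induction deg (p := fun x => φ (D x) = E.d (φ x)) (by simp)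
    (fun x y hx hy => by simp only [map_add, hx, hy])
    (fun q x hx => by simp only [map_smul, hx]) ?_ (fun i hi l hl ih => ?_) hx
  · have h1 : D 1 = 0 := by
      simpa using hD (n := 0) (a := 1) 1 SetLike.GradedOne.one_mem
    rw [h1, map_zero, map_one, E.d_one]
  · rw [hD _ (gen_mem_gr deg i), map_add, map_smul, map_mul, map_mul, map_mul, ih, hS i hi,
      E.leibniz (hφ i) (map_mem_gr E φ hφ (prod_mem_gr deg l))]

/-- D raises degree by one, so the two mixed terms in D²(xy) have opposite signs and cancel. -/
theorem d_d_of_mem_adjoin (D : FreeCGA deg →ₗ[ℚ] FreeCGA deg)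
    (hmem : ∀ {n : ℕ} {a : FreeCGA deg}, a ∈ gr deg n → D a ∈ gr deg (n + 1))
    (hD : ∀ {n : ℕ} {a : FreeCGA deg} (b : FreeCGA deg), a ∈ gr deg n →
      D (a * b) = D a * b + (-1 : ℚ) ^ n • (a * D b))
    {S : Set ι} (hS : ∀ i ∈ S, D (D (gen deg i)) = 0)
    {x : FreeCGA deg} (hx : x ∈ Algebra.adjoin ℚ (gen deg '' S)) : D (D x) = 0 := by
  refine adjoin_gen_induction deg (p := fun x => D (D x) = 0) (by simp)
    (fun x y hx hy => by simp only [map_add, hx, hy, add_zero])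
    (fun q x hx => by simp only [map_smul, hx, smul_zero]) ?_ (fun i hi l hl ih => ?_) hx
  · have h1 : D 1 = 0 := by
      simpa using hD (n := 0) (a := 1) 1 SetLike.GradedOne.one_mem
    rw [h1, map_zero]
  · rw [hD _ (gen_mem_gr deg i), map_add, map_smul, hD _ (gen_mem_gr deg i),
      hD _ (hmem (gen_mem_gr deg i)), hS i hi, ih, pow_succ]
    simp

theorem algHom_eq_of_mem_adjoin {φ ψ : FreeCGA deg →ₐ[ℚ] R} {S : Set ι}
    (h : ∀ i ∈ S, φ (gen deg i) = ψ (gen deg i)) {x : FreeCGA deg}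
    (hx : x ∈ Algebra.adjoin ℚ (gen deg '' S)) : φ x = ψ x := by
  have : Algebra.adjoin ℚ (gen deg '' S) ≤ AlgHom.equalizer φ ψ := by
    refine Algebra.adjoin_le ?_
    rintro _ ⟨i, hi, rfl⟩
    exact h i hi
  exact this hx

end Hom

section Derivation

variable {deg}

theorem derivation_comm {δ : ι → FreeCGA deg} (hδ : ∀ i, δ i ∈ gr deg (deg i + 1)) (i j : ι) :
    (!![(-1 : ℚ) ^ deg i • gen deg i, δ i; 0, gen deg i] : Matrix (Fin 2) (Fin 2) (FreeCGA deg)) *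
      !![(-1 : ℚ) ^ deg j • gen deg j, δ j; 0, gen deg j] = (-1 : ℚ) ^ (deg i * deg j) •
      (!![(-1 : ℚ) ^ deg j • gen deg j, δ j; 0, gen deg j] *
        !![(-1 : ℚ) ^ deg i • gen deg i, δ i; 0, gen deg i]) := by
  have h1 := graded_comm deg (gen_mem_gr deg i) (gen_mem_gr deg j)
  have h2 := graded_comm deg (gen_mem_gr deg i) (hδ j)
  have h3 := graded_comm deg (hδ i) (gen_mem_gr deg j)
  have s : ∀ n : ℕ, (-1 : ℚ) ^ n * (-1) ^ n = 1 := fun n => by rw [← mul_pow]; simp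
  rw [Matrix.mul_fin_two, Matrix.mul_fin_two, Matrix.smul_of]
  ext a b
  fin_cases a <;> fin_cases b
  · simp [h1, smul_smul]
    congr 1; ring
  · simp only [Matrix.of_apply, Fin.zero_eta, Fin.mk_one, Matrix.cons_val', Matrix.cons_val_zero,
      Matrix.cons_val_one, Matrix.smul_cons, smul_add, smul_mul_assoc, h2, h3, smul_smul,
      Matrix.cons_val_fin_one]
    rw [add_comm]
    congr 2
    · rw [add_mul, one_mul, pow_add]
    · rw [mul_add, mul_one, pow_add, mul_comm, mul_assoc, s, mul_one]
  · simp
  · simp [h1]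

/-- A degree +1 derivation D is the same as an algebra map a ↦ ((-1)^|a| a, Da; 0, a) into upper
triangular matrices, so the universal property of the free algebra produces it; `derivation_comm`
checks the relations. -/
theorem exists_derivation (δ : ι → FreeCGA deg) (hδ : ∀ i, δ i ∈ gr deg (deg i + 1)) :
    ∃ D : FreeCGA deg →ₗ[ℚ] FreeCGA deg, (∀ i, D (gen deg i) = δ i) ∧
      (∀ {n : ℕ} {a : FreeCGA deg}, a ∈ gr deg n → D a ∈ gr deg (n + 1)) ∧
      ∀ {n : ℕ} {a : FreeCGA deg} (b : FreeCGA deg), a ∈ gr deg n →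
        D (a * b) = D a * b + (-1 : ℚ) ^ n • (a * D b) := by
  let Φ := lift deg (fun i => (!![(-1 : ℚ) ^ deg i • gen deg i, δ i; 0, gen deg i] :
    Matrix (Fin 2) (Fin 2) (FreeCGA deg))) (derivation_comm hδ)
  have hgen : ∀ i, Φ (gen deg i) = !![(-1 : ℚ) ^ deg i • gen deg i, δ i; 0, gen deg i] :=
    fun i => lift_gen deg _ _ i
  have key : ∀ {n : ℕ} {a : FreeCGA deg}, a ∈ gr deg n →
      Φ a 0 0 = (-1 : ℚ) ^ n • a ∧ Φ a 1 0 = 0 ∧ Φ a 1 1 = a ∧ Φ a 0 1 ∈ gr deg (n + 1) := by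
    intro n a ha
    induction ha using Submodule.span_induction with
    | zero => simp
    | add x y _ _ hx hy =>
      simp only [map_add, Matrix.add_apply, hx, hy, smul_add, add_zero, true_and]
      exact Submodule.add_mem _ hx.2.2.2 hy.2.2.2
    | smul q x _ hx =>
      simp only [map_smul, Matrix.smul_apply, hx, smul_zero, true_and]
      exact ⟨smul_comm _ _ _, Submodule.smul_mem _ _ hx.2.2.2⟩
    | mem x h =>
      obtain ⟨l, rfl, rfl⟩ := h
      induction l with
      | nil => simp
      | cons i l ih =>
        obtain ⟨h1, h2, h3, h4⟩ := ih
        simp only [List.map_cons, List.prod_cons, List.sum_cons, map_mul, Matrix.mul_apply,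
          Fin.sum_univ_two, hgen, h1, h2, h3]
        simp only [Matrix.of_apply, Matrix.cons_val', Matrix.cons_val_zero, Matrix.cons_val_one,
          Matrix.cons_val_fin_one, mul_zero, zero_mul, add_zero, zero_add, true_and,
          pow_add, smul_mul_smul_comm]
        rw [smul_mul_assoc]
        refine Submodule.add_mem _ (Submodule.smul_mem _ _ ?_) ?_
        · rw [add_assoc]
          exact SetLike.GradedMul.mul_mem (A := gr deg) (gen_mem_gr deg i) h4
        · rw [add_right_comm]
          exact SetLike.GradedMul.mul_mem (A := gr deg) (hδ i) (prod_mem_gr deg l)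
  have h11 : ∀ a, Φ a 1 1 = a := by
    intro a
    induction a using DirectSum.Decomposition.inductionOn (gr deg) with
    | zero => simp
    | homogeneous m => exact (key m.2).2.2.1
    | add a b ha hb => rw [map_add, Matrix.add_apply, ha, hb]
  refine ⟨(Matrix.entryLinearMap ℚ (FreeCGA deg) 0 1).comp Φ.toLinearMap, ?_, ?_, ?_⟩
  · intro i
    simp [hgen]
  · intro n a ha
    exact (key ha).2.2.2
  · intro n a b ha
    change Φ (a * b) 0 1 = Φ a 0 1 * b + (-1 : ℚ) ^ n • (a * Φ b 0 1)
    rw [map_mul, Matrix.mul_apply, Fin.sum_univ_two, (key ha).1, h11, smul_mul_assoc, add_comm]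

end Derivation

end FreeCGA

/-! ### Constructing maps out of a Sullivan algebra level by level. -/

theorem exists_seq_of_step {Y : Type*} (P : ℕ → Y → Prop) (r : ℕ → Y → Y → Prop) {y₀ : Y}
    (h₀ : P 0 y₀) (step : ∀ n y, P n y → ∃ y', r n y y' ∧ P (n + 1) y') :
    ∃ s : ℕ → Y, ∀ n, P n (s n) ∧ r n (s n) (s (n + 1)) := by
  choose next hnext using step
  let s : ∀ n, {y // P n y} := fun n =>
    Nat.rec ⟨y₀, h₀⟩ (fun n y => ⟨next n y.1 y.2, (hnext n y.1 y.2).2⟩) n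
  exact ⟨fun n => (s n).1, fun n => ⟨(s n).2, (hnext n (s n).1 (s n).2).1⟩⟩

namespace SullivanAlgebra

open FreeCGA

/-- The differential of a generator involves only lower levels, so its image is already determined
when the generator's own value is chosen. The predicate `good` carries further conditions through
the induction. -/
theorem exists_algHom_of_step (M : SullivanAlgebra.{u}) {R : Type*} [Ring R] [Algebra ℚ R]
    (E : HomogeneousDGA R) (good : M.ι → R → Prop)
    (step : ∀ (φ : FreeCGA M.deg →ₐ[ℚ] R) (i : M.ι),
      (∀ j, φ (gen M.deg j) ∈ E.gr (M.deg j)) →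
      (∀ j, M.level j < M.level i →
        φ (M.d (gen M.deg j)) = E.d (φ (gen M.deg j)) ∧ good j (φ (gen M.deg j))) →
      ∃ y ∈ E.gr (M.deg i), φ (M.d (gen M.deg i)) = E.d y ∧ good i y) :
    ∃ φ : FreeCGA M.deg →ₐ[ℚ] R, ∀ i, φ (gen M.deg i) ∈ E.gr (M.deg i) ∧
      φ (M.d (gen M.deg i)) = E.d (φ (gen M.deg i)) ∧ good i (φ (gen M.deg i)) := by
  classical
  let L : (∀ i, E.gr (M.deg i)) → FreeCGA M.deg →ₐ[ℚ] R := fun y =>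
    lift M.deg (fun i => (y i : R)) fun i j => E.mul_comm' (y i).2 (y j).2
  have hL : ∀ y i, L y (gen M.deg i) = y i := fun y i => lift_gen M.deg _ _ i
  have hagree : ∀ (n : ℕ) (y y' : ∀ i, E.gr (M.deg i)), (∀ j, M.level j < n → y' j = y j) →
      ∀ i, M.level i ≤ n → L y' (M.d (gen M.deg i)) = L y (M.d (gen M.deg i)) := by
    intro n y y' h i hi
    refine algHom_eq_of_mem_adjoin (fun j hj => ?_) (M.nilpotent i)
    have hj' : M.level j < M.level i := hj
    rw [hL, hL, h j (by omega)]
  let P : ℕ → (∀ i, E.gr (M.deg i)) → Prop := fun n y => ∀ i, M.level i < n →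
    L y (M.d (gen M.deg i)) = E.d (y i) ∧ good i (y i)
  obtain ⟨s, hs⟩ := exists_seq_of_step P
    (fun n y y' => ∀ j, M.level j < n → y' j = y j) (y₀ := 0)
    (fun i hi => absurd hi (Nat.not_lt_zero _)) (by
      intro n y hy
      have h : ∀ i, M.level i = n →
          ∃ z ∈ E.gr (M.deg i), L y (M.d (gen M.deg i)) = E.d z ∧ good i z := by
        rintro i rfl
        refine step (L y) i (fun j => by rw [hL]; exact (y j).2) fun j hj => ?_
        rw [hL]
        exact hy j hj
      choose z hz using h
      let y' : ∀ i, E.gr (M.deg i) := fun i =>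
        if hi : M.level i = n then ⟨z i hi, (hz i hi).1⟩ else y i
      have h1 : ∀ j, M.level j < n → y' j = y j := fun j hj => dif_neg hj.ne
      refine ⟨y', h1, fun i hi => ?_⟩
      rw [hagree n y y' h1 i (by omega)]
      by_cases hin : M.level i = n
      · simp only [y', dif_pos hin]
        exact (hz i hin).2
      · rw [h1 i (by omega)]
        exact hy i (by omega))
  have hstab : ∀ (m n : ℕ) (j : M.ι), M.level j < n → s (n + m) j = s n j := by
    intro m n j hj
    induction m with
    | zero => rfl
    | succ m ih => rw [← add_assoc, (hs (n + m)).2 j (by omega), ih]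
  -- Stage `level i + 1` is the first at which the value on `i` has been chosen; it never changes
  -- afterwards.
  let y : ∀ i, E.gr (M.deg i) := fun i => s (M.level i + 1) i
  have hy : ∀ n j, M.level j < n → y j = s n j := by
    intro n j hj
    obtain ⟨m, rfl⟩ := Nat.exists_eq_add_of_lt hj
    have := hstab m (M.level j + 1) j (by omega)
    rw [show M.level j + m + 1 = M.level j + 1 + m by omega, this]
  refine ⟨L y, fun i => ?_⟩
  have h := (hs (M.level i + 1)).1 i (by omega)
  rw [hagree (M.level i + 1) (s (M.level i + 1)) y (hy _) i (by omega), hL]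
  exact ⟨(y i).2, h⟩

end SullivanAlgebra

/-! ### Products, shifted gradings, and polynomials with coefficients in a CDGA. -/

/-- The product of two homogeneous structures. -/
def HomogeneousDGA.prod {R S : Type*} [Ring R] [Algebra ℚ R] [Ring S] [Algebra ℚ S]
    (E : HomogeneousDGA R) (E' : HomogeneousDGA S) : HomogeneousDGA (R × S) where
  gr n := (E.gr n).prod (E'.gr n)
  one_mem := ⟨E.one_mem, E'.one_mem⟩
  mul_mem ha hb := ⟨E.mul_mem ha.1 hb.1, E'.mul_mem ha.2 hb.2⟩
  mul_comm' ha hb := Prod.ext (E.mul_comm' ha.1 hb.1) (E'.mul_comm' ha.2 hb.2)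
  d := E.d.prodMap E'.d
  leibniz ha hb := Prod.ext (E.leibniz ha.1 hb.1) (E'.leibniz ha.2 hb.2)

/-- The grading shifted by one. -/
def shiftGr {V : Type*} [AddCommGroup V] [Module ℚ V] (gr : ℕ → Submodule ℚ V) :
    ℕ → Submodule ℚ V
  | 0 => ⊥
  | n + 1 => gr n

namespace Polynomial

/-- The antiderivative without constant term. -/
noncomputable def antiderivative : ℚ[X] →ₗ[ℚ] ℚ[X] :=
  lsum fun n => ((n + 1 : ℚ)⁻¹) • monomial (n + 1)

theorem antiderivative_monomial (n : ℕ) (q : ℚ) :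
    antiderivative (monomial n q) = monomial (n + 1) ((n + 1 : ℚ)⁻¹ * q) := by
  simp [antiderivative, lsum_apply, sum_monomial_index, smul_monomial]

theorem derivative_antiderivative (f : ℚ[X]) : derivative (antiderivative f) = f := by
  induction f using Polynomial.induction_on' with
  | add f g hf hg => simp only [map_add, hf, hg]
  | monomial n q =>
    rw [antiderivative_monomial, derivative_monomial]
    congr 1
    have : (n + 1 : ℚ) ≠ 0 := by positivity
    push_cast
    field_simp

theorem antiderivative_derivative (f : ℚ[X]) :
    antiderivative (derivative f) = f - C (f.eval 0) := by
  induction f using Polynomial.induction_on' with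
  | add f g hf hg => simp only [map_add, hf, hg, eval_add]; ring
  | monomial n q =>
    cases n with
    | zero => simp
    | succ n =>
      rw [derivative_monomial, antiderivative_monomial, eval_monomial]
      have : (n + 1 : ℚ) ≠ 0 := by positivity
      simp [mul_comm q, this]

theorem eval_zero_antiderivative (f : ℚ[X]) : (antiderivative f).eval 0 = 0 := by
  induction f using Polynomial.induction_on' with
  | add f g hf hg => simp only [map_add, hf, hg, eval_add, add_zero]
  | monomial n q => rw [antiderivative_monomial, eval_monomial]; simp

end Polynomial

namespace CDGA

open scoped TensorProduct Polynomial

variable (D : CDGA.{u})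

/-- Polynomials in one variable of degree `0` with coefficients in `D`. -/
noncomputable abbrev PolyAlg : Type u := ℚ[X] ⊗[ℚ] D.carrier

namespace PolyAlg

/-- The polynomials with coefficients in degree `n`. -/
noncomputable def gr (n : ℕ) : Submodule ℚ D.PolyAlg :=
  Submodule.span ℚ {x | ∃ (f : ℚ[X]) (a : D.carrier), a ∈ D.gr n ∧ f ⊗ₜ[ℚ] a = x}

/-- The differential of `D` applied to coefficients. -/
noncomputable def d : D.PolyAlg →ₗ[ℚ] D.PolyAlg := LinearMap.lTensor ℚ[X] D.d

/-- The derivative in the polynomial variable. -/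
noncomputable def deriv : D.PolyAlg →ₗ[ℚ] D.PolyAlg :=
  LinearMap.rTensor D.carrier Polynomial.derivative

/-- The antiderivative in the polynomial variable. -/
noncomputable def integral : D.PolyAlg →ₗ[ℚ] D.PolyAlg :=
  LinearMap.rTensor D.carrier Polynomial.antiderivative

/-- Evaluation of the polynomial variable. -/
noncomputable def eval (q : ℚ) : D.PolyAlg →ₐ[ℚ] D.carrier :=
  Algebra.TensorProduct.lift ((Algebra.ofId ℚ D.carrier).comp (Polynomial.aeval q))
    (AlgHom.id ℚ D.carrier) fun _ _ => Algebra.commutes _ _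

variable {D}

@[simp] theorem d_tmul (f : ℚ[X]) (a : D.carrier) : d D (f ⊗ₜ a) = f ⊗ₜ D.d a := rfl

@[simp] theorem deriv_tmul (f : ℚ[X]) (a : D.carrier) :
    deriv D (f ⊗ₜ a) = Polynomial.derivative f ⊗ₜ a := rfl

@[simp] theorem integral_tmul (f : ℚ[X]) (a : D.carrier) :
    integral D (f ⊗ₜ a) = Polynomial.antiderivative f ⊗ₜ a := rfl

@[simp] theorem eval_tmul (q : ℚ) (f : ℚ[X]) (a : D.carrier) :
    eval D q (f ⊗ₜ a) = f.eval q • a := by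
  rw [Algebra.smul_def, ← Polynomial.coe_aeval_eq_eval]
  rfl

theorem tmul_mem {n : ℕ} (f : ℚ[X]) {a : D.carrier} (ha : a ∈ D.gr n) : f ⊗ₜ[ℚ] a ∈ gr D n :=
  Submodule.subset_span ⟨f, a, ha, rfl⟩

theorem one_mem : (1 : D.PolyAlg) ∈ gr D 0 :=
  tmul_mem 1 (SetLike.GradedOne.one_mem (A := D.gr))

theorem mul_mem {m n : ℕ} {x y : D.PolyAlg} (hx : x ∈ gr D m) (hy : y ∈ gr D n) :
    x * y ∈ gr D (m + n) := by
  have h := Submodule.mul_mem_mul hx hy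
  rw [gr, gr, Submodule.span_mul_span] at h
  refine Submodule.span_mono ?_ h
  rintro _ ⟨_, ⟨f, a, ha, rfl⟩, _, ⟨g, b, hb, rfl⟩, rfl⟩
  exact ⟨f * g, a * b, SetLike.GradedMul.mul_mem ha hb, by simp⟩

theorem comm {m n : ℕ} {x y : D.PolyAlg} (hx : x ∈ gr D m) (hy : y ∈ gr D n) :
    x * y = (-1 : ℚ) ^ (m * n) • (y * x) := by
  induction hx using Submodule.span_induction with
  | zero => simp
  | add x x' _ _ hx hx' => rw [add_mul, mul_add, hx, hx', smul_add]
  | smul q x _ hx => rw [smul_mul_assoc, mul_smul_comm, hx, smul_comm]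
  | mem x h =>
    obtain ⟨f, a, ha, rfl⟩ := h
    induction hy using Submodule.span_induction with
    | zero => simp
    | add x x' _ _ hx hx' => rw [add_mul, mul_add, hx, hx', smul_add]
    | smul q x _ hx => rw [smul_mul_assoc, mul_smul_comm, hx, smul_comm]
    | mem y h =>
      obtain ⟨g, b, hb, rfl⟩ := h
      rw [Algebra.TensorProduct.tmul_mul_tmul, Algebra.TensorProduct.tmul_mul_tmul,
        D.mul_comm' ha hb, mul_comm f, TensorProduct.tmul_smul]

theorem leibniz {m : ℕ} {x : D.PolyAlg} (y : D.PolyAlg) (hx : x ∈ gr D m) :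
    d D (x * y) = d D x * y + (-1 : ℚ) ^ m • (x * d D y) := by
  induction hx using Submodule.span_induction with
  | zero => simp
  | add x x' _ _ hx hx' => simp only [add_mul, map_add, hx, hx', smul_add]; abel
  | smul q x _ hx =>
    simp only [smul_mul_assoc, map_smul, hx, smul_add]
    rw [smul_comm q]
  | mem x h =>
    obtain ⟨f, a, ha, rfl⟩ := h
    induction y using TensorProduct.induction_on with
    | zero => simp
    | add y y' hy hy' => simp only [mul_add, map_add, hy, hy', smul_add]; abel
    | tmul g b =>
      simp [D.leibniz b ha, TensorProduct.tmul_add]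

theorem deriv_mul (x y : D.PolyAlg) : deriv D (x * y) = deriv D x * y + x * deriv D y := by
  induction x using TensorProduct.induction_on with
  | zero => simp
  | add x x' hx hx' => simp only [add_mul, map_add, hx, hx']; abel
  | tmul f a =>
    induction y using TensorProduct.induction_on with
    | zero => simp
    | add y y' hy hy' => simp only [mul_add, map_add, hy, hy']; abel
    | tmul g b => simp [TensorProduct.add_tmul]

theorem d_integral (x : D.PolyAlg) : d D (integral D x) = integral D (d D x) := by
  induction x using TensorProduct.induction_on with
  | zero => simp
  | add x x' hx hx' => simp only [map_add, hx, hx']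
  | tmul f a => simp

theorem deriv_integral (x : D.PolyAlg) : deriv D (integral D x) = x := by
  induction x using TensorProduct.induction_on with
  | zero => simp
  | add x x' hx hx' => simp only [map_add, hx, hx']
  | tmul f a => simp [Polynomial.derivative_antiderivative]

theorem integral_deriv (x : D.PolyAlg) :
    integral D (deriv D x) = x - 1 ⊗ₜ eval D 0 x := by
  induction x using TensorProduct.induction_on with
  | zero => simp
  | add x x' hx hx' => simp only [map_add, hx, hx', TensorProduct.tmul_add]; abel
  | tmul f a =>
    rw [deriv_tmul, integral_tmul, Polynomial.antiderivative_derivative, eval_tmul,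
      TensorProduct.sub_tmul, TensorProduct.tmul_smul, TensorProduct.smul_tmul',
      Polynomial.smul_eq_C_mul, mul_one]

theorem eval_zero_integral (x : D.PolyAlg) : eval D 0 (integral D x) = 0 := by
  induction x using TensorProduct.induction_on with
  | zero => simp
  | add x x' hx hx' => simp only [map_add, hx, hx', add_zero]
  | tmul f a => simp [Polynomial.eval_zero_antiderivative]

theorem eval_d (q : ℚ) (x : D.PolyAlg) : eval D q (d D x) = D.d (eval D q x) := by
  induction x using TensorProduct.induction_on with
  | zero => simp
  | add x x' hx hx' => simp only [map_add, hx, hx']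
  | tmul f a => simp

theorem integral_mem {n : ℕ} {x : D.PolyAlg} (hx : x ∈ gr D n) : integral D x ∈ gr D n := by
  induction hx using Submodule.span_induction with
  | zero => simp
  | add x x' _ _ hx hx' => rw [map_add]; exact Submodule.add_mem _ hx hx'
  | smul q x _ hx => rw [map_smul]; exact Submodule.smul_mem _ _ hx
  | mem x h =>
    obtain ⟨f, a, ha, rfl⟩ := h
    exact tmul_mem _ ha

theorem eval_mem (q : ℚ) {n : ℕ} {x : D.PolyAlg} (hx : x ∈ gr D n) : eval D q x ∈ D.gr n := by
  induction hx using Submodule.span_induction with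
  | zero => simp
  | add x x' _ _ hx hx' => rw [map_add]; exact Submodule.add_mem _ hx hx'
  | smul q x _ hx => rw [map_smul]; exact Submodule.smul_mem _ _ hx
  | mem x h =>
    obtain ⟨f, a, ha, rfl⟩ := h
    rw [eval_tmul]
    exact Submodule.smul_mem _ _ ha

/-- The fundamental theorem of calculus: the hypothesis is the dt-part of closedness of p + dt q,
and the endpoints then differ by d of the integral of q over [0, 1]. -/
theorem eval_one_sub_eval_zero {p q : D.PolyAlg} (h : deriv D p = d D q) :
    eval D 1 p - eval D 0 p = D.d (eval D 1 (integral D q)) := by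
  rw [← eval_d, d_integral, ← h, integral_deriv, map_sub, eval_tmul]
  simp

end PolyAlg

end CDGA

/-! ### The path object, with dt encoded by matrices. -/

namespace HomogeneousDGA

variable {S : Type*} [Ring S] [Algebra ℚ S] (E : HomogeneousDGA S)

theorem mul_shift_mem {m n : ℕ} {p q : S} (hp : p ∈ E.gr m) (hq : q ∈ shiftGr E.gr n) :
    p * q ∈ shiftGr E.gr (m + n) := by
  cases n with
  | zero => rw [(Submodule.mem_bot ℚ).1 hq, mul_zero]; exact Submodule.zero_mem _
  | succ n => exact E.mul_mem hp hq

theorem shift_mul_mem {m n : ℕ} {p q : S} (hq : q ∈ shiftGr E.gr m) (hp : p ∈ E.gr n) :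
    q * p ∈ shiftGr E.gr (m + n) := by
  cases m with
  | zero => rw [(Submodule.mem_bot ℚ).1 hq, zero_mul]; exact Submodule.zero_mem _
  | succ m => rw [Nat.succ_add]; exact E.mul_mem hq hp

theorem shift_comm {m n : ℕ} {p q : S} (hq : q ∈ shiftGr E.gr m) (hp : p ∈ E.gr n) :
    q * p = (-1 : ℚ) ^ ((m + 1) * n) • (p * q) := by
  cases m with
  | zero => rw [(Submodule.mem_bot ℚ).1 hq]; simp
  | succ m =>
    have : (m + 1 + 1) * n = m * n + 2 * n := by ring
    rw [E.mul_comm' hq hp, this, pow_add, pow_mul (-1 : ℚ) 2]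
    simp

theorem shift_leibniz {m n : ℕ} {p q : S} (hq : q ∈ shiftGr E.gr m) (hp : p ∈ E.gr n) :
    E.d (q * p) = E.d q * p - (-1 : ℚ) ^ m • (q * E.d p) := by
  cases m with
  | zero => rw [(Submodule.mem_bot ℚ).1 hq]; simp
  | succ m =>
    rw [E.leibniz hq hp, pow_succ, mul_neg_one, neg_smul, sub_neg_eq_add]

theorem leibniz_shift {m n : ℕ} {p q : S} (hp : p ∈ E.gr m) (hq : q ∈ shiftGr E.gr n) :
    E.d (p * q) = E.d p * q + (-1 : ℚ) ^ m • (p * E.d q) := by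
  cases n with
  | zero => rw [(Submodule.mem_bot ℚ).1 hq]; simp
  | succ n => exact E.leibniz hp hq

/-- For an algebra `S` of polynomials in a variable `t`, the element of degree `n` of the path
object which represents `p + dt q`, for `p` of degree `n`. The matrix encodes the sign rule
`p dt = (-1)ⁿ dt p`. -/
def pathMk (S : Type*) [Ring S] [Algebra ℚ S] (n : ℕ) :
    S × S →ₗ[ℚ] S × Matrix (Fin 2) (Fin 2) S where
  -- The first factor repeats p so that it can be read off by an algebra map; a matrix entry is not
  -- multiplicative on all matrices.
  toFun x := (x.1, !![(-1 : ℚ) ^ n • x.1, x.2; 0, x.1])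
  map_add' x y := by
    refine Prod.ext rfl ?_
    ext a b
    fin_cases a <;> fin_cases b <;> simp
  map_smul' q x := by
    refine Prod.ext rfl ?_
    ext a b
    fin_cases a <;> fin_cases b <;> simp [smul_comm q]

theorem pathMk_apply (n : ℕ) (x : S × S) :
    pathMk S n x = (x.1, !![(-1 : ℚ) ^ n • x.1, x.2; 0, x.1]) := rfl

theorem pathMk_mul (m n : ℕ) (x y : S × S) : pathMk S m x * pathMk S n y =
    pathMk S (m + n) (x.1 * y.1, (-1 : ℚ) ^ m • (x.1 * y.2) + x.2 * y.1) := by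
  rw [pathMk_apply, pathMk_apply, pathMk_apply, Prod.mk_mul_mk, Matrix.mul_fin_two]
  simp only [smul_mul_assoc, mul_smul_comm, smul_smul, smul_zero, mul_zero, zero_mul, add_zero,
    zero_add, ← pow_add, add_comm n m]

theorem pathMk_one : pathMk S 0 (1, 0) = 1 := by
  rw [pathMk_apply, ← Prod.mk_one_one, Matrix.one_fin_two, pow_zero, one_smul]

variable (t : S →ₗ[ℚ] S)

/-- The differential `p + dt q ↦ d p + dt (∂ p - d q)` of the path object. -/
def pathD : S × Matrix (Fin 2) (Fin 2) S →ₗ[ℚ] S × Matrix (Fin 2) (Fin 2) S where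
  -- The corner (-1)ⁿ p must go to (-1)ⁿ⁺¹ dp; the minus sign achieves this without reference to n.
  toFun x := (E.d x.1, !![-E.d (x.2 0 0), t x.1 - E.d (x.2 0 1); 0, E.d x.1])
  map_add' x y := by
    refine Prod.ext (map_add _ _ _) ?_
    ext a b
    fin_cases a <;> fin_cases b <;> simp <;> abel
  map_smul' q x := by
    refine Prod.ext (map_smul _ _ _) ?_
    ext a b
    fin_cases a <;> fin_cases b <;> simp [smul_sub]

theorem pathD_pathMk (n : ℕ) (x : S × S) :
    E.pathD t (pathMk S n x) = pathMk S (n + 1) (E.d x.1, t x.1 - E.d x.2) := by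
  have h : E.pathD t (pathMk S n x) =
    (E.d x.1, !![-E.d ((-1 : ℚ) ^ n • x.1), t x.1 - E.d x.2; 0, E.d x.1]) := rfl
  rw [h, pathMk_apply, map_smul, pow_succ, mul_neg_one, neg_smul]

/-- The path object: the part `S ⊕ dt S` of `D ⊗ Λ(t, dt)`, where `S = D ⊗ ℚ[t]`. -/
def path (ht : ∀ x y, t (x * y) = t x * y + x * t y) :
    HomogeneousDGA (S × Matrix (Fin 2) (Fin 2) S) where
  gr n := ((E.gr n).prod (shiftGr E.gr n)).map (pathMk S n)
  one_mem := ⟨(1, 0), ⟨E.one_mem, Submodule.zero_mem _⟩, pathMk_one⟩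
  mul_mem := by
    rintro m n _ _ ⟨x, ⟨hp, hq⟩, rfl⟩ ⟨y, ⟨hp', hq'⟩, rfl⟩
    rw [pathMk_mul]
    exact ⟨_, ⟨E.mul_mem hp hp', Submodule.add_mem _
      (Submodule.smul_mem _ _ (E.mul_shift_mem hp hq')) (E.shift_mul_mem hq hp')⟩, rfl⟩
  mul_comm' := by
    rintro m n _ _ ⟨x, ⟨hp, hq⟩, rfl⟩ ⟨y, ⟨hp', hq'⟩, rfl⟩
    rw [pathMk_mul, pathMk_mul, add_comm n m, ← map_smul]
    congr 1
    refine Prod.ext (E.mul_comm' hp hp') ?_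
    have s : ∀ n : ℕ, (-1 : ℚ) ^ n * (-1) ^ n = 1 := fun n => by rw [← mul_pow]; simp
    change (-1 : ℚ) ^ m • (x.1 * y.2) + x.2 * y.1 =
      (-1 : ℚ) ^ (m * n) • ((-1 : ℚ) ^ n • (y.1 * x.2) + y.2 * x.1)
    rw [E.shift_comm hq hp', E.shift_comm hq' hp, smul_add, smul_smul, smul_smul, add_comm]
    congr 2
    · rw [add_mul, one_mul, pow_add]
    · rw [add_mul, one_mul, pow_add, mul_comm n m, ← mul_assoc, s, one_mul]
  d := E.pathD t
  leibniz := by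
    rintro m n _ _ ⟨x, ⟨hp, hq⟩, rfl⟩ ⟨y, ⟨hp', hq'⟩, rfl⟩
    have s : ∀ n : ℕ, (-1 : ℚ) ^ n * (-1) ^ n = 1 := fun n => by rw [← mul_pow]; simp
    rw [pathMk_mul, pathD_pathMk, pathD_pathMk, pathD_pathMk, pathMk_mul, pathMk_mul,
      show m + 1 + n = m + n + 1 by omega, ← add_assoc, ← map_smul, ← map_add]
    congr 1
    refine Prod.ext (E.leibniz hp hp') ?_
    simp only [map_add, map_smul, E.leibniz_shift hp hq', E.shift_leibniz hq hp', ht,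
      Prod.snd_add, Prod.smul_snd, smul_add, smul_smul, s, one_smul, mul_sub, sub_mul, smul_sub,
      pow_succ, mul_neg_one, neg_smul]
    abel

end HomogeneousDGA

/-- The homogeneous structure on polynomials with coefficients in a CDGA. -/
noncomputable def CDGA.PolyAlg.toHomogeneousDGA (D : CDGA.{u}) : HomogeneousDGA D.PolyAlg where
  gr := gr D
  one_mem := one_mem
  mul_mem := mul_mem
  mul_comm' := comm
  d := d D
  leibniz hx _ := leibniz _ hx

/-! ### Lifting through quasi-isomorphisms up to homotopy. -/

namespace CDGA

theorem toCohomology_eq {A : CDGA.{u}} {x y : A.cocycles} :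
    A.toCohomology x = A.toCohomology y ↔ ∃ c : A.carrier, (x : A.carrier) - y = A.d c := by
  rw [← sub_eq_zero, ← map_sub, toCohomology_eq_zero]
  rfl

end CDGA

namespace CDGA.Hom

open scoped TensorProduct Polynomial

variable {C D : CDGA.{u}}

theorem map_proj (w : Hom C D) (n : ℕ) (a : C.carrier) :
    w.toAlgHom (GradedAlgebra.proj C.gr n a) = GradedAlgebra.proj D.gr n (w.toAlgHom a) := by
  induction a using DirectSum.Decomposition.inductionOn C.gr with
  | zero => simp
  | @homogeneous i m =>
    by_cases h : i = n
    · subst h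
      rw [C.proj_same m.2, D.proj_same (w.map_gr m.2)]
    · rw [C.proj_ne m.2 h, D.proj_ne (w.map_gr m.2) h, map_zero]
  | add a b ha hb => simp only [map_add, ha, hb]

theorem exists_d_eq_of_map {w : Hom C D} (hw : w.IsQuasiIso) {m : ℕ} {z : C.carrier}
    (hz : z ∈ C.gr (m + 1)) (hdz : C.d z = 0) {b : D.carrier} (hb : w.toAlgHom z = D.d b) :
    ∃ c ∈ C.gr m, C.d c = z := by
  have h : w.cohomologyMap.toAlgHom (C.toCohomology ⟨z, hdz⟩) = 0 :=
    D.toCohomology_eq_zero.2 ⟨b, hb⟩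
  rw [← map_zero w.cohomologyMap.toAlgHom] at h
  obtain ⟨c, hc⟩ := C.toCohomology_eq_zero.1 (hw.1 h)
  refine ⟨GradedAlgebra.proj C.gr m c, C.proj_mem m c, ?_⟩
  have hc' : z = C.d c := hc
  rw [← C.proj_succ_d, ← hc', C.proj_same hz]

/-- Surjectivity in cohomology, made homogeneous by projecting the cocycle and the primitive. In
degree 0 the shifted grading forces the primitive to vanish. -/
theorem exists_map_add_d {w : Hom C D} (hw : w.IsQuasiIso) {m : ℕ} {x : D.carrier}
    (hx : x ∈ D.gr m) (hdx : D.d x = 0) :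
    ∃ c ∈ C.gr m, C.d c = 0 ∧ ∃ e ∈ shiftGr D.gr m, x = w.toAlgHom c + D.d e := by
  obtain ⟨y, hy⟩ := hw.2 (D.toCohomology ⟨x, hdx⟩)
  obtain ⟨c, rfl⟩ := C.toCohomology_surjective y
  obtain ⟨e, he⟩ := toCohomology_eq.1 hy.symm
  have he' : x - w.toAlgHom c = D.d e := he
  refine ⟨GradedAlgebra.proj C.gr m c, C.proj_mem m c, (C.cocyclesProj m c).2, ?_⟩
  have key : x = w.toAlgHom (GradedAlgebra.proj C.gr m c) +
      GradedAlgebra.proj D.gr m (D.d e) := by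
    rw [← he', map_sub, map_proj, D.proj_same hx]
    abel
  cases m with
  | zero => exact ⟨0, Submodule.zero_mem _, by rw [key, D.proj_zero_d, map_zero]⟩
  | succ m =>
    exact ⟨GradedAlgebra.proj D.gr m e, D.proj_mem m e, by rw [← D.proj_succ_d, ← key]⟩

open PolyAlg in
/-- Lifting of one generator against the path fibration of a quasi-isomorphism. -/
theorem exists_path_lift {w : Hom C D} (hw : w.IsQuasiIso) {k : ℕ} {z : C.carrier}
    (hz : z ∈ C.gr (k + 1)) (hdz : C.d z = 0) {p q : D.PolyAlg}
    (hq : q ∈ PolyAlg.gr D k) (hpq : deriv D p = PolyAlg.d D q)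
    (hp0 : PolyAlg.eval D 0 p = w.toAlgHom z) {e : D.carrier} (he : e ∈ D.gr k)
    (hp1 : PolyAlg.eval D 1 p = D.d e) :
    ∃ c ∈ C.gr k, C.d c = z ∧ ∃ P ∈ PolyAlg.gr D k, ∃ Q ∈ shiftGr (PolyAlg.gr D) k,
      PolyAlg.d D P = p ∧ deriv D P - PolyAlg.d D Q = q ∧
      PolyAlg.eval D 0 P = w.toAlgHom c ∧ PolyAlg.eval D 1 P = e := by
  have hev := eval_one_sub_eval_zero hpq
  -- Since p(1) = de and p(1) - p(0) = d∫q, the image w z = p(0) is exact, so z is exact by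
  -- injectivity in cohomology.
  obtain ⟨c₀, hc₀, rfl⟩ := exists_d_eq_of_map hw hz hdz
    (b := e - PolyAlg.eval D 1 (integral D q)) (by
      rw [map_sub, ← hev, ← hp1, ← hp0]; abel)
  -- The path w c₀ + ∫q starts correctly but misses e at t = 1. The defect is closed; up to an exact
  -- term de' it comes from a cocycle c₁ of C, which is subtracted from c₀.
  obtain ⟨c₁, hc₁, hdc₁, e', he', hx⟩ := exists_map_add_d hw
    (x := w.toAlgHom c₀ + PolyAlg.eval D 1 (integral D q) - e)
    (Submodule.sub_mem _ (Submodule.add_mem _ (w.map_gr hc₀) (eval_mem 1 (integral_mem hq))) he)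
    (by rw [map_sub, map_add, ← hev, ← hp1, ← w.map_d, ← hp0]; abel)
  have hde' : D.d e' ∈ D.gr k := by
    cases k with
    | zero => rw [(Submodule.mem_bot ℚ).1 he', map_zero]; exact Submodule.zero_mem _
    | succ k => exact D.d_mem he'
  -- The term -t de' removes the remaining defect at t = 1 without moving t = 0; Q = -e' cancels its
  -- derivative in t.
  refine ⟨c₀ - c₁, Submodule.sub_mem _ hc₀ hc₁, by rw [map_sub, hdc₁, sub_zero],
    (1 : ℚ[X]) ⊗ₜ w.toAlgHom (c₀ - c₁) + integral D q - (Polynomial.X : ℚ[X]) ⊗ₜ D.d e', ?_,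
    -((1 : ℚ[X]) ⊗ₜ e'), ?_, ?_, ?_, ?_, ?_⟩
  · exact Submodule.sub_mem _ (Submodule.add_mem _
      (tmul_mem _ (w.map_gr (Submodule.sub_mem _ hc₀ hc₁))) (integral_mem hq)) (tmul_mem _ hde')
  · refine Submodule.neg_mem _ ?_
    cases k with
    | zero =>
      rw [(Submodule.mem_bot ℚ).1 he', TensorProduct.tmul_zero]
      exact Submodule.zero_mem _
    | succ k => exact tmul_mem (D := D) _ he'
  · rw [map_sub, map_add, d_integral, ← hpq, integral_deriv, d_tmul, d_tmul, D.d_d, ← w.map_d,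
      map_sub, hdc₁, sub_zero, hp0]
    simp
  · rw [map_sub, map_add, deriv_integral, map_neg, deriv_tmul, deriv_tmul, d_tmul]
    simp
  · rw [map_sub, map_add, eval_zero_integral]
    simp
  · rw [map_sub, map_add, eval_tmul, eval_tmul, map_sub]
    have : D.d e' = w.toAlgHom c₀ + PolyAlg.eval D 1 (integral D q) - e - w.toAlgHom c₁ := by
      rw [hx]; abel
    rw [this]
    simp
    abel

end CDGA.Hom

namespace CDGA.Hom

open FreeCGA

variable {C D : CDGA.{u}}

/-- Maps from a Sullivan algebra lift through quasi-isomorphisms, up to homotopy. -/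
theorem exists_lift (M : SullivanAlgebra.{u}) {w : Hom C D} (hw : w.IsQuasiIso)
    (φ : Hom M.toCDGA D) :
    ∃ ψ : Hom M.toCDGA C, ∀ x, w.cohomologyMap.toAlgHom (ψ.cohomologyMap.toAlgHom x) =
      φ.cohomologyMap.toAlgHom x := by
  let E := C.toHomogeneousDGA.prod ((PolyAlg.toHomogeneousDGA D).path (PolyAlg.deriv D)
    PolyAlg.deriv_mul)
  let R := C.carrier × D.PolyAlg × Matrix (Fin 2) (Fin 2) D.PolyAlg
  let pr : R →ₐ[ℚ] C.carrier := AlgHom.fst ℚ _ _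
  let ev : ℚ → R →ₐ[ℚ] D.carrier := fun q =>
    (PolyAlg.eval D q).comp ((AlgHom.fst ℚ _ _).comp (AlgHom.snd ℚ _ _))
  let φ' : FreeCGA M.deg →ₐ[ℚ] D.carrier := φ.toAlgHom
  -- The endpoint conditions replace a fibre product: a path from w ∘ ψ to φ, where ψ is the
  -- component in C.
  let good : M.ι → R → Prop := fun i x =>
    ev 0 x = w.toAlgHom (pr x) ∧ ev 1 x = φ' (gen M.deg i)
  obtain ⟨Θ, hΘ⟩ := M.exists_algHom_of_step E good (by
    intro Θ i hgr hlow
    have hda : M.d (gen M.deg i) ∈ FreeCGA.gr M.deg (M.deg i + 1) :=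
      M.d_mem (gen_mem_gr M.deg i)
    have hmem := map_mem_gr E Θ hgr hda
    have hd : E.d (Θ (M.d (gen M.deg i))) = 0 := by
      rw [← map_d_of_mem_adjoin E Θ hgr M.d M.leibniz (fun j hj => (hlow j hj).1)
        (M.nilpotent i), M.d_d, map_zero]
    have h0 : ev 0 (Θ (M.d (gen M.deg i))) = w.toAlgHom (pr (Θ (M.d (gen M.deg i)))) :=
      algHom_eq_of_mem_adjoin (φ := (ev 0).comp Θ) (ψ := (w.toAlgHom.comp pr).comp Θ)
        (fun j hj => (hlow j hj).2.1) (M.nilpotent i)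
    have h1 : ev 1 (Θ (M.d (gen M.deg i))) = φ' (M.d (gen M.deg i)) :=
      algHom_eq_of_mem_adjoin (φ := (ev 1).comp Θ) (ψ := φ')
        (fun j hj => (hlow j hj).2.2) (M.nilpotent i)
    rw [show φ' (M.d (gen M.deg i)) = D.d (φ' (gen M.deg i)) from φ.map_d _] at h1
    generalize Θ (M.d (gen M.deg i)) = a at hmem hd h0 h1
    obtain ⟨z, b⟩ := a
    obtain ⟨hz, ⟨p, q⟩, ⟨hp, hq⟩, hb⟩ := hmem
    change HomogeneousDGA.pathMk _ _ _ = b at hb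
    subst hb
    have hdz : C.d z = 0 := congrArg Prod.fst hd
    have hdb : (PolyAlg.toHomogeneousDGA D).pathD (PolyAlg.deriv D)
      (HomogeneousDGA.pathMk _ (M.deg i + 1) (p, q)) = 0 := congrArg Prod.snd hd
    have hpq : PolyAlg.deriv D p - PolyAlg.d D q = 0 :=
      congrArg (fun x => x.2 0 1) hdb
    obtain ⟨c, hc, hcz, P, hP, Q, hQ, hdP, hdQ, hP0, hP1⟩ :=
      exists_path_lift hw hz hdz hq (sub_eq_zero.1 hpq) h0 (φ.map_gr (gen_mem_gr M.deg i)) h1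
    refine ⟨(c, HomogeneousDGA.pathMk _ (M.deg i) (P, Q)), ⟨hc, (P, Q), ⟨hP, hQ⟩, rfl⟩, ?_, hP0,
      hP1⟩
    refine Prod.ext hcz.symm ?_
    change _ = (PolyAlg.toHomogeneousDGA D).pathD (PolyAlg.deriv D)
      (HomogeneousDGA.pathMk _ (M.deg i) (P, Q))
    rw [HomogeneousDGA.pathD_pathMk]
    exact congrArg (HomogeneousDGA.pathMk D.PolyAlg (M.deg i + 1))
      (Prod.ext hdP.symm hdQ.symm : (p, q) = (_, _)))
  have hgr : ∀ i, Θ (gen M.deg i) ∈ E.gr (M.deg i) := fun i => (hΘ i).1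
  have hd : ∀ x, Θ (M.d x) = E.d (Θ x) := fun x =>
    map_d_of_mem_adjoin E Θ hgr M.d M.leibniz (fun j _ => (hΘ j).2.1) (mem_adjoin_univ _ x)
  have h0 : ∀ x, ev 0 (Θ x) = w.toAlgHom (pr (Θ x)) := fun x =>
    algHom_eq_of_mem_adjoin (φ := (ev 0).comp Θ) (ψ := (w.toAlgHom.comp pr).comp Θ)
      (fun j _ => (hΘ j).2.2.1) (mem_adjoin_univ _ x)
  have h1 : ∀ x, ev 1 (Θ x) = φ' x := fun x =>
    algHom_eq_of_mem_adjoin (φ := (ev 1).comp Θ) (ψ := φ')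
      (fun j _ => (hΘ j).2.2.2) (mem_adjoin_univ _ x)
  refine ⟨⟨pr.comp Θ, fun ha => (map_mem_gr E Θ hgr ha).1, fun a => congrArg Prod.fst (hd a)⟩, ?_⟩
  intro x
  obtain ⟨x, rfl⟩ := M.toCDGA.toCohomology_surjective x
  symm
  refine toCohomology_eq.2 ?_
  have hx : E.d (Θ (x.1 : FreeCGA M.deg)) = 0 := by
    have hdx : M.d (x.1 : FreeCGA M.deg) = 0 := x.2
    exact (hd _).symm.trans ((congrArg Θ hdx).trans (map_zero Θ))
  have hx' : PolyAlg.deriv D (Θ (x.1 : FreeCGA M.deg)).2.1 -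
      PolyAlg.d D ((Θ (x.1 : FreeCGA M.deg)).2.2 0 1) = 0 :=
    congrArg (fun x => x.2.2 0 1) hx
  -- On a cocycle the path is closed, so its two endpoints φ(x) and w(ψ(x)) are cohomologous.
  have h := PolyAlg.eval_one_sub_eval_zero (sub_eq_zero.1 hx')
  refine ⟨_, Eq.trans ?_ h⟩
  exact congrArg₂ _ (h1 _).symm (h0 _).symm

theorem mem_gr_of_map_mem_gr {f : Hom C D} (hf : Function.Injective f.toAlgHom) {n : ℕ}
    {a : C.carrier} (ha : f.toAlgHom a ∈ D.gr n) : a ∈ C.gr n := by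
  have : GradedAlgebra.proj C.gr n a = a := hf (by rw [map_proj, D.proj_same ha])
  rw [← this]
  exact C.proj_mem n a

/-- The inverse of a bijective morphism. -/
noncomputable def inverse (f : Hom C D) (hf : Function.Bijective f.toAlgHom) : Hom D C where
  toAlgHom := (AlgEquiv.ofBijective f.toAlgHom hf).symm
  map_gr {n a} ha := mem_gr_of_map_mem_gr hf.1 (by
    have : f.toAlgHom ((AlgEquiv.ofBijective f.toAlgHom hf).symm a) = a :=
      (AlgEquiv.ofBijective f.toAlgHom hf).apply_symm_apply a
    exact (congrArg (· ∈ D.gr n) this).mpr ha)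
  map_d a := hf.1 (by
    have : ∀ a, f.toAlgHom ((AlgEquiv.ofBijective f.toAlgHom hf).symm a) = a :=
      (AlgEquiv.ofBijective f.toAlgHom hf).apply_symm_apply
    rw [f.map_d]
    exact (this _).trans (congrArg D.d (this a)).symm)

theorem inverse_apply (f : Hom C D) (hf : Function.Bijective f.toAlgHom) (a : C.carrier) :
    (f.inverse hf).toAlgHom (f.toAlgHom a) = a :=
  (AlgEquiv.ofBijective f.toAlgHom hf).symm_apply_apply a

theorem apply_inverse (f : Hom C D) (hf : Function.Bijective f.toAlgHom) (a : D.carrier) :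
    f.toAlgHom ((f.inverse hf).toAlgHom a) = a :=
  (AlgEquiv.ofBijective f.toAlgHom hf).apply_symm_apply a

end CDGA.Hom

/-! ### Transport along zigzags and formality of retracts. -/

namespace CDGA

/-- A quasi-isomorphism class gives an isomorphism in cohomology which is compatible with
maps from Sullivan algebras. -/
theorem IsQuasiIsomorphic.exists_cohomology_iso {C D : CDGA.{u}} (h : C.IsQuasiIsomorphic D) :
    ∃ (θ : Hom C.cohomology D.cohomology) (η : Hom D.cohomology C.cohomology),
      (∀ x, η.toAlgHom (θ.toAlgHom x) = x) ∧ (∀ x, θ.toAlgHom (η.toAlgHom x) = x) ∧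
      (∀ (M : SullivanAlgebra.{u}) (φ : Hom M.toCDGA C), ∃ ψ : Hom M.toCDGA D,
        ∀ x, ψ.cohomologyMap.toAlgHom x = θ.toAlgHom (φ.cohomologyMap.toAlgHom x)) ∧
      ∀ (M : SullivanAlgebra.{u}) (ψ : Hom M.toCDGA D), ∃ φ : Hom M.toCDGA C,
        ∀ x, φ.cohomologyMap.toAlgHom x = η.toAlgHom (ψ.cohomologyMap.toAlgHom x) := by
  induction h with
  | rel C D h =>
    obtain ⟨w, hw⟩ := h
    -- Transport along w is composition; transport against w is the lifting theorem. Having both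
    -- directions in the statement makes the symmetric case immediate.
    refine ⟨w.cohomologyMap, w.cohomologyMap.inverse hw, Hom.inverse_apply _ hw,
      Hom.apply_inverse _ hw, fun M φ => ⟨w.comp φ, fun x => ?_⟩, fun M ψ => ?_⟩
    · obtain ⟨x, rfl⟩ := M.toCDGA.toCohomology_surjective x
      rfl
    · obtain ⟨φ, hφ⟩ := Hom.exists_lift M hw ψ
      refine ⟨φ, fun x => ?_⟩
      rw [← hφ]
      exact (Hom.inverse_apply _ hw _).symm
  | refl C =>
    exact ⟨Hom.id _, Hom.id _, fun _ => rfl, fun _ => rfl, fun M φ => ⟨φ, fun _ => rfl⟩,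
      fun M φ => ⟨φ, fun _ => rfl⟩⟩
  | symm C D _ ih =>
    obtain ⟨θ, η, h1, h2, h3, h4⟩ := ih
    exact ⟨η, θ, h2, h1, h4, h3⟩
  | trans C D E _ _ ih ih' =>
    obtain ⟨θ, η, h1, h2, h3, h4⟩ := ih
    obtain ⟨θ', η', h1', h2', h3', h4'⟩ := ih'
    refine ⟨θ'.comp θ, η.comp η', fun x => ?_, fun x => ?_, fun M φ => ?_, fun M ψ => ?_⟩
    · exact (congrArg _ (h1' _)).trans (h1 x)
    · exact (congrArg _ (h2 _)).trans (h2' x)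
    · obtain ⟨ψ, hψ⟩ := h3 M φ
      obtain ⟨χ, hχ⟩ := h3' M ψ
      exact ⟨χ, fun x => (hχ x).trans (congrArg _ (hψ x))⟩
    · obtain ⟨ψ', hψ⟩ := h4' M ψ
      obtain ⟨χ, hχ⟩ := h4 M ψ'
      exact ⟨χ, fun x => (hχ x).trans (congrArg _ (hψ x))⟩

/-- The isomorphism `(Z, 0) → H(Z, 0)` for `(Z, 0) = (H(A), 0)`. -/
noncomputable def toCohomologyCohomology (A : CDGA.{u}) :
    Hom A.cohomology A.cohomology.cohomology where
  toAlgHom := A.cohomology.toCohomology.comp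
    ((AlgHom.id ℚ A.cohomology.carrier).codRestrict A.cohomology.cocycles fun _ => rfl)
  map_gr ha := ⟨_, ha, rfl⟩
  map_d _ := map_zero _

theorem toCohomologyCohomology_injective (A : CDGA.{u}) :
    Function.Injective A.toCohomologyCohomology.toAlgHom := by
  intro x y hxy
  obtain ⟨c, hc⟩ := toCohomology_eq.1 hxy
  have : x - y = 0 := hc
  exact sub_eq_zero.1 this

theorem toCohomologyCohomology_surjective (A : CDGA.{u}) :
    Function.Surjective A.toCohomologyCohomology.toAlgHom := by
  intro x
  obtain ⟨z, rfl⟩ := A.cohomology.toCohomology_surjective x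
  exact ⟨z, rfl⟩

/-- A retract of a formal CDGA is formal, provided that it has a minimal model. -/
theorem IsFormal.of_retract {A B : CDGA.{u}} (hB : B.IsFormal) (f : Hom A B) (g : Hom B A)
    (hgf : g.comp f = Hom.id A) {M : SullivanAlgebra.{u}} (hM : M.IsMinimalModel A) :
    A.IsFormal := by
  obtain ⟨N, ⟨-, n, hn⟩, hN⟩ := hB
  obtain ⟨hmin, m, hm⟩ := hM
  have hBB : B.IsQuasiIsomorphic B.cohomology :=
    Relation.EqvGen.trans _ _ _ (Relation.EqvGen.symm _ _ (Relation.EqvGen.rel _ _ ⟨n, hn⟩)) hN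
  obtain ⟨θ, η, hηθ, -, hlift, -⟩ := hBB.exists_cohomology_iso
  obtain ⟨ψ, hψ⟩ := hlift M (f.comp m)
  -- The zigzag may induce any isomorphism θ on cohomology; inserting η cancels it, so that g ∘ f =
  -- Id can be applied.
  let ρ : Hom M.toCDGA A.cohomology :=
    ((g.cohomologyMap.comp η).comp B.toCohomologyCohomology).comp ψ
  refine ⟨M, ⟨hmin, m, hm⟩, Relation.EqvGen.rel _ _ ⟨ρ, ?_⟩⟩
  have hρ : ∀ x, ρ.cohomologyMap.toAlgHom x =
      A.toCohomologyCohomology.toAlgHom (m.cohomologyMap.toAlgHom x) := by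
    intro y
    obtain ⟨x, hx⟩ := M.toCDGA.toCohomology_surjective y
    have h1 : ρ.toAlgHom x = g.cohomologyMap.toAlgHom (η.toAlgHom
        (ψ.cohomologyMap.toAlgHom y)) := by
      rw [← hx]; rfl
    have h2 : g.cohomologyMap.toAlgHom ((f.comp m).cohomologyMap.toAlgHom y) =
        ((g.comp f).comp m).cohomologyMap.toAlgHom y := by
      rw [← hx]; rfl
    rw [hψ, hηθ, h2, hgf] at h1
    rw [← hx] at h1 ⊢
    exact congrArg A.toCohomologyCohomology.toAlgHom h1
  rw [Hom.IsQuasiIso, show ⇑ρ.cohomologyMap.toAlgHom = _ from funext hρ]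
  exact Function.Bijective.comp
    ⟨A.toCohomologyCohomology_injective, A.toCohomologyCohomology_surjective⟩ hm

end CDGA

/-! ### Minimal models: linear algebra, degree counts and the supply of generators. -/

theorem Submodule.exists_basis_mod {V : Type*} [AddCommGroup V] [Module ℚ V]
    (K L : Submodule ℚ V) : ∃ S : Set V, S ⊆ K ∧
      (∀ v ∈ K, ∃ c ∈ Finsupp.supported ℚ ℚ S, v - Finsupp.linearCombination ℚ id c ∈ L) ∧
      ∀ c ∈ Finsupp.supported ℚ ℚ S, Finsupp.linearCombination ℚ id c ∈ L → c = 0 := by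
  -- S is a maximal subset of K that is linearly independent modulo L; no inclusion L ≤ K is needed.
  obtain ⟨S, hSK, -, hspan, hind⟩ := exists_linearIndepOn_extension
    (linearIndepOn_empty ℚ L.mkQ) (Set.empty_subset (K : Set V))
  have hmk : ∀ c : V →₀ ℚ, Finsupp.linearCombination ℚ L.mkQ c =
      L.mkQ (Finsupp.linearCombination ℚ id c) := fun c => by
    rw [Finsupp.apply_linearCombination]; rfl
  refine ⟨S, hSK, fun v hv => ?_, fun c hc h => ?_⟩
  · obtain ⟨c, hc, hcv⟩ := (Finsupp.mem_span_image_iff_linearCombination ℚ).1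
      (hspan (Set.mem_image_of_mem L.mkQ hv))
    refine ⟨c, hc, ?_⟩
    rw [hmk, ← sub_eq_zero, ← map_sub, Submodule.mkQ_apply, Submodule.Quotient.mk_eq_zero] at hcv
    rw [← neg_sub]
    exact Submodule.neg_mem _ hcv
  · refine linearIndepOn_iff.1 hind c hc ?_
    rw [hmk, Submodule.mkQ_apply]
    exact (Submodule.Quotient.mk_eq_zero L).2 h

theorem List.eq_nil_or_two_le_sum {ι : Type*} {deg : ι → ℕ} {l : List ι}
    (hl : ∀ i ∈ l, 2 ≤ deg i) : l = [] ∨ 2 ≤ (l.map deg).sum := by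
  cases l with
  | nil => exact Or.inl rfl
  | cons i l =>
    right
    have := hl i (by simp)
    rw [List.map_cons, List.sum_cons]
    omega

/-- The absence of generators of degree 1 leaves a gap: any further factor raises the degree by at
least 2. Thus new generators of degree n + 1 contribute nothing in degree n + 2. -/
theorem List.eq_singleton_or_lt_sum {ι : Type*} {deg : ι → ℕ} {l : List ι}
    (hl : ∀ i ∈ l, 2 ≤ deg i) {i : ι} (hi : i ∈ l) :
    l = [i] ∨ deg i + 2 ≤ (l.map deg).sum := by
  obtain ⟨s, t, rfl⟩ := List.append_of_mem hi
  have hs := List.eq_nil_or_two_le_sum (l := s) (deg := deg) fun j hj => hl j (by simp [hj])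
  have ht := List.eq_nil_or_two_le_sum (l := t) (deg := deg) fun j hj => hl j (by simp [hj])
  rw [List.map_append, List.sum_append, List.map_cons, List.sum_cons]
  rcases hs with rfl | hs
  · rcases ht with rfl | ht
    · exact Or.inl rfl
    · right; simp only [List.map_nil, List.sum_nil]; omega
  · right; omega

-- The generators are to be indexed by data that includes elements of the free algebra on them.
-- Cardinality resolves the circularity: for infinite T with |A| ≤ |T|, the free algebra on ℕ × T
-- has at most |T| elements.
open Cardinal in
theorem FreeCGA.exists_surjective_generators (A : Type u) [Nonempty A] :
    ∃ (T : Type u) (s : T → FreeCGA (fun i : ℕ × T => i.1) × A), Function.Surjective s := by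
  let T : Type u := A ⊕ ULift.{u} ℕ
  have hT : ℵ₀ ≤ Cardinal.mk T := aleph0_le_mk T
  have hAT : Cardinal.mk A ≤ Cardinal.mk T := mk_le_of_injective (f := Sum.inl) Sum.inl_injective
  have hNT : Cardinal.mk (ℕ × T) ≤ Cardinal.mk T := by
    rw [mk_prod, lift_uzero, mk_nat, lift_aleph0]
    exact (mul_eq_right hT hT aleph0_ne_zero).le
  have hF : Cardinal.mk (FreeCGA (fun i : ℕ × T => i.1)) ≤ Cardinal.mk T := by
    refine (mk_le_of_surjective (FreeCGA.mk_surjective _)).trans ?_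
    refine (FreeAlgebra.cardinalMk_le_max_lift ℚ (ℕ × T)).trans ?_
    rw [lift_uzero]
    refine max_le (max_le ?_ hNT) hT
    rw [mk_eq_aleph0 ℚ, lift_aleph0]
    exact hT
  have h : Cardinal.mk (FreeCGA (fun i : ℕ × T => i.1) × A) ≤ Cardinal.mk T := by
    rw [mk_prod, lift_id, lift_id]
    exact mul_le_of_le hT hF hAT
  obtain ⟨e⟩ := (le_def _ _).1 h
  exact ⟨T, Function.invFun e, Function.invFun_surjective e.injective⟩

/-- A free graded-commutative algebra with a derivation (not necessarily of square zero) and an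
algebra map to `A`, with so many generators that their images are arbitrary. -/
structure CDGA.GeneratorSupply (A : CDGA.{u}) where
  ι : Type u
  deg : ι → ℕ
  D : FreeCGA deg →ₗ[ℚ] FreeCGA deg
  d_mem : ∀ {n : ℕ} {a : FreeCGA deg}, a ∈ FreeCGA.gr deg n → D a ∈ FreeCGA.gr deg (n + 1)
  leibniz : ∀ {n : ℕ} {a : FreeCGA deg} (b : FreeCGA deg), a ∈ FreeCGA.gr deg n →
    D (a * b) = D a * b + (-1 : ℚ) ^ n • (a * D b)
  m : FreeCGA deg →ₐ[ℚ] A.carrier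
  m_gen : ∀ i, m (FreeCGA.gen deg i) ∈ A.gr (deg i)
  r : ℕ → FreeCGA deg × A.carrier → ι
  deg_r : ∀ n x, deg (r n x) = n
  D_r : ∀ n x, x.1 ∈ FreeCGA.gr deg (n + 1) → D (FreeCGA.gen deg (r n x)) = x.1
  m_r : ∀ n x, x.2 ∈ A.gr n → m (FreeCGA.gen deg (r n x)) = x.2

theorem CDGA.nonempty_generatorSupply (A : CDGA.{u}) : Nonempty A.GeneratorSupply := by
  obtain ⟨T, s, hs⟩ := FreeCGA.exists_surjective_generators A.carrier
  let deg : ℕ × T → ℕ := fun i => i.1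
  let μ : ℕ × T → A.carrier := fun i => GradedAlgebra.proj A.gr i.1 (s i.2).2
  have hμ : ∀ i, μ i ∈ A.gr (deg i) := fun i => A.proj_mem _ _
  obtain ⟨D, hD, hmem, hleib⟩ := FreeCGA.exists_derivation (deg := deg)
    (fun i => GradedAlgebra.proj (FreeCGA.gr deg) (i.1 + 1) (s i.2).1)
    (fun i => SetLike.coe_mem _)
  have hm := FreeCGA.lift_gen deg μ fun i j => A.mul_comm' (hμ i) (hμ j)
  exact ⟨{
    ι := ℕ × T
    deg := deg
    D := D
    d_mem := hmem
    leibniz := hleib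
    m := FreeCGA.lift deg μ fun i j => A.mul_comm' (hμ i) (hμ j)
    m_gen := fun i => by rw [hm]; exact hμ i
    r := fun n x => (n, Function.surjInv hs x)
    deg_r := fun _ _ => rfl
    D_r := fun n x hx => by
      rw [hD, Function.surjInv_eq hs, GradedAlgebra.proj_apply,
        DirectSum.decompose_of_mem_same _ hx]
    m_r := fun n x hx => by
      rw [hm]
      change GradedAlgebra.proj A.gr n (s (Function.surjInv hs x)).2 = _
      rw [Function.surjInv_eq hs, A.proj_same hx] }⟩

/-! ### Selecting generators degree by degree. -/

namespace CDGA.GeneratorSupply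

open FreeCGA

variable {A : CDGA.{u}} (G : A.GeneratorSupply)

/-- The subalgebra generated by a set of generators. -/
noncomputable abbrev sub (U : Set G.ι) : Subalgebra ℚ (FreeCGA G.deg) :=
  Algebra.adjoin ℚ (gen G.deg '' U)

theorem sub_mono {U U' : Set G.ι} (h : U ⊆ U') : G.sub U ≤ G.sub U' :=
  Algebra.adjoin_mono (Set.image_mono h)

theorem m_mem {n : ℕ} {x : FreeCGA G.deg} (hx : x ∈ FreeCGA.gr G.deg n) : G.m x ∈ A.gr n :=
  map_mem_gr A.toHomogeneousDGA G.m G.m_gen hx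

/-- The generators in `U` span a Sullivan algebra with a morphism to `A`. -/
structure IsModel (U : Set G.ι) : Prop where
  two_le : ∀ i ∈ U, 2 ≤ G.deg i
  nilpotent : ∀ i ∈ U, G.D (gen G.deg i) ∈ G.sub {j ∈ U | G.deg j < G.deg i}
  d_d : ∀ i ∈ U, G.D (G.D (gen G.deg i)) = 0
  m_d : ∀ i ∈ U, G.m (G.D (gen G.deg i)) = A.d (G.m (gen G.deg i))

/-- The morphism from the algebra generated by `U` to `A` is surjective in cohomology in
degree `k`. -/
def SurjectiveAt (U : Set G.ι) (k : ℕ) : Prop :=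
  ∀ a ∈ A.gr k, A.d a = 0 →
    ∃ y ∈ G.sub U, y ∈ FreeCGA.gr G.deg k ∧ G.D y = 0 ∧ ∃ c, a - G.m y = A.d c

/-- The morphism from the algebra generated by `U` to `A` is injective in cohomology in
degree `k`. -/
def InjectiveAt (U : Set G.ι) (k : ℕ) : Prop :=
  ∀ y ∈ G.sub U, y ∈ FreeCGA.gr G.deg k → G.D y = 0 → (∃ c, G.m y = A.d c) →
    ∃ x ∈ G.sub U, y = G.D x

variable {G}

theorem IsModel.D_mem {U : Set G.ι} (hU : G.IsModel U) {x : FreeCGA G.deg} (hx : x ∈ G.sub U) :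
    G.D x ∈ G.sub U := by
  refine adjoin_gen_induction G.deg (p := fun x => G.D x ∈ G.sub U)
    (by rw [map_zero]; exact zero_mem _)
    (fun x y hx hy => by rw [map_add]; exact add_mem hx hy)
    (fun q x hx => by rw [map_smul]; exact Subalgebra.smul_mem _ hx q) ?_
    (fun i hi l hl ih => ?_) hx
  · have h1 : G.D 1 = 0 := by
      simpa using G.leibniz (n := 0) (a := 1) 1 SetLike.GradedOne.one_mem
    rw [h1]
    exact zero_mem _
  · rw [G.leibniz _ (gen_mem_gr G.deg i)]
    exact add_mem (mul_mem (G.sub_mono (fun _ h => h.1) (hU.nilpotent i hi))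
      (prod_mem_adjoin G.deg hl))
      (Subalgebra.smul_mem _ (mul_mem (gen_mem_adjoin G.deg hi) ih) _)

theorem IsModel.D_D {U : Set G.ι} (hU : G.IsModel U) {x : FreeCGA G.deg} (hx : x ∈ G.sub U) :
    G.D (G.D x) = 0 :=
  d_d_of_mem_adjoin G.D G.d_mem G.leibniz hU.d_d hx

theorem IsModel.m_D {U : Set G.ι} (hU : G.IsModel U) {x : FreeCGA G.deg} (hx : x ∈ G.sub U) :
    G.m (G.D x) = A.d (G.m x) :=
  map_d_of_mem_adjoin A.toHomogeneousDGA G.m G.m_gen G.D G.leibniz hU.m_d hx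

theorem mem_sub_of_mem_sub {U U' : Set G.ι} {k : ℕ}
    (h : ∀ l : List G.ι, (∀ i ∈ l, i ∈ U') → (l.map G.deg).sum = k → ∀ i ∈ l, i ∈ U)
    {x : FreeCGA G.deg} (hx : x ∈ G.sub U') (hk : x ∈ FreeCGA.gr G.deg k) : x ∈ G.sub U := by
  have hx' := mem_span_of_mem_adjoin_of_mem_gr G.deg hx hk
  rw [← Subalgebra.mem_toSubmodule]
  refine Submodule.span_le.2 ?_ hx'
  rintro _ ⟨l, hl, hk, rfl⟩
  exact prod_mem_adjoin G.deg (h l hl hk)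

/-- The cocycles of degree `n + 1` of the mapping cone. -/
noncomputable def relCocycles (G : A.GeneratorSupply) (U : Set G.ι) (n : ℕ) :
    Submodule ℚ (FreeCGA G.deg × A.carrier) where
  carrier := {x | x.1 ∈ G.sub U ∧ x.1 ∈ FreeCGA.gr G.deg (n + 1) ∧ G.D x.1 = 0 ∧ x.2 ∈ A.gr n ∧
    A.d x.2 = G.m x.1}
  add_mem' := by
    rintro x y ⟨h1, h2, h3, h4, h5⟩ ⟨h1', h2', h3', h4', h5'⟩
    refine ⟨add_mem h1 h1', add_mem h2 h2', ?_, add_mem h4 h4', ?_⟩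
    · rw [Prod.fst_add, map_add, h3, h3', add_zero]
    · rw [Prod.snd_add, Prod.fst_add, map_add, map_add, h5, h5']
  zero_mem' := ⟨zero_mem _, zero_mem _, map_zero _, zero_mem _, by simp⟩
  smul_mem' := by
    rintro q x ⟨h1, h2, h3, h4, h5⟩
    refine ⟨Subalgebra.smul_mem _ h1 q, Submodule.smul_mem _ q h2, ?_,
      Submodule.smul_mem _ q h4, ?_⟩
    · rw [Prod.smul_fst, map_smul, h3, smul_zero]
    · rw [Prod.smul_snd, Prod.smul_fst, map_smul, map_smul, h5]

/-- The coboundaries of degree `n + 1` of the mapping cone. -/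
noncomputable def relCoboundaries (G : A.GeneratorSupply) (U : Set G.ι) (n : ℕ) :
    Submodule ℚ (FreeCGA G.deg × A.carrier) where
  carrier := {x | ∃ y ∈ G.sub U, y ∈ FreeCGA.gr G.deg n ∧ x.1 = G.D y ∧ ∃ c, x.2 = G.m y + A.d c}
  add_mem' := by
    rintro x x' ⟨y, h1, h2, h3, c, h4⟩ ⟨y', h1', h2', h3', c', h4'⟩
    refine ⟨y + y', add_mem h1 h1', add_mem h2 h2', ?_, c + c', ?_⟩
    · rw [Prod.fst_add, map_add, h3, h3']
    · rw [Prod.snd_add, map_add, map_add, h4, h4']; abel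
  zero_mem' := ⟨0, zero_mem _, zero_mem _, by simp, 0, by simp⟩
  smul_mem' := by
    rintro q x ⟨y, h1, h2, h3, c, h4⟩
    refine ⟨q • y, Subalgebra.smul_mem _ h1 q, Submodule.smul_mem _ q h2, ?_, q • c, ?_⟩
    · rw [Prod.smul_fst, map_smul, h3]
    · rw [Prod.smul_snd, map_smul, map_smul, h4, smul_add]

/-- The generator attached to a relative cocycle (x, a) has differential x and image a, so a
combination of such generators returns the combination of the pairs. -/
theorem linearCombination_apply_of_supported {U : Set G.ι} {n : ℕ}
    {S : Set (FreeCGA G.deg × A.carrier)} (hS : S ⊆ G.relCocycles U n)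
    {c : FreeCGA G.deg × A.carrier →₀ ℚ} (hc : c ∈ Finsupp.supported ℚ ℚ S) :
    (G.D (Finsupp.linearCombination ℚ (fun s => gen G.deg (G.r n s)) c),
      G.m (Finsupp.linearCombination ℚ (fun s => gen G.deg (G.r n s)) c)) =
      Finsupp.linearCombination ℚ id c := by
  have key : Finsupp.supported ℚ ℚ S ≤ LinearMap.eqLocus
      ((G.D.prod G.m.toLinearMap).comp
        (Finsupp.linearCombination ℚ fun s => gen G.deg (G.r n s)))
      (Finsupp.linearCombination ℚ id) := by
    rw [Finsupp.supported_eq_span_single, Submodule.span_le]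
    rintro _ ⟨s, hs, rfl⟩
    obtain ⟨-, h2, -, h4, -⟩ := hS hs
    simp [G.D_r n s h2, G.m_r n s h4]
  exact key hc

/-- New generators of degree n + 1 are attached along a basis of the cohomology of the mapping cone.
Spanning gives surjectivity in degree n + 1 and injectivity in degree n + 2; independence keeps
injectivity in degree n + 1. -/
theorem exists_step {U : Set G.ι} {n : ℕ} (hn : 1 ≤ n) (hU : G.IsModel U)
    (hle : ∀ i ∈ U, G.deg i ≤ n) (hsurj : ∀ k ≤ n, G.SurjectiveAt U k)
    (hinj : ∀ k ≤ n + 1, G.InjectiveAt U k) :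
    ∃ U' : Set G.ι, U ⊆ U' ∧ (∀ i ∈ U', i ∉ U → G.deg i = n + 1) ∧ G.IsModel U' ∧
      (∀ k ≤ n + 1, G.SurjectiveAt U' k) ∧ ∀ k ≤ n + 2, G.InjectiveAt U' k := by
  obtain ⟨S, hSK, hspan, hind⟩ := Submodule.exists_basis_mod (G.relCocycles U (n + 1))
    (G.relCoboundaries U (n + 1))
  let v : FreeCGA G.deg × A.carrier → FreeCGA G.deg := fun s => gen G.deg (G.r (n + 1) s)
  let N : Set G.ι := G.r (n + 1) '' S
  have hN : ∀ i ∈ U ∪ N, i ∉ U → G.deg i = n + 1 := by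
    rintro i (hi | ⟨s, -, rfl⟩) hi'
    · exact absurd hi hi'
    · exact G.deg_r _ _
  have hUN : U ⊆ U ∪ N := Set.subset_union_left
  have htwo : ∀ i ∈ U ∪ N, 2 ≤ G.deg i := by
    intro i hi
    by_cases hiU : i ∈ U
    · exact hU.two_le i hiU
    · have := hN i hi hiU
      omega
  have hlow : ∀ {k : ℕ}, k ≤ n + 2 → k ≠ n + 1 → ∀ {x : FreeCGA G.deg}, x ∈ G.sub (U ∪ N) →
      x ∈ FreeCGA.gr G.deg k → x ∈ G.sub U := by
    intro k hk hk' x hx hxk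
    refine mem_sub_of_mem_sub (fun l hl hlk i hi => ?_) hx hxk
    by_contra hiU
    have hdi := hN i (hl i hi) hiU
    rcases List.eq_singleton_or_lt_sum (fun j hj => htwo j (hl j hj)) hi with rfl | h
    · simp at hlk; omega
    · omega
  have hmodel : G.IsModel (U ∪ N) := by
    refine ⟨htwo, ?_, ?_, ?_⟩
    · rintro i (hi | ⟨s, hs, rfl⟩)
      · exact G.sub_mono (U' := {j ∈ U ∪ N | G.deg j < G.deg i}) (fun j hj => ⟨Or.inl hj.1, hj.2⟩)
          (hU.nilpotent i hi)
      · obtain ⟨h1, h2, -, -, -⟩ := hSK hs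
        rw [G.D_r _ s h2]
        refine G.sub_mono (U' := {j ∈ U ∪ N | G.deg j < G.deg (G.r (n + 1) s)})
          (fun j hj => ⟨Or.inl hj, ?_⟩) h1
        rw [G.deg_r]
        exact Nat.lt_succ_of_le (hle j hj)
    · rintro i (hi | ⟨s, hs, rfl⟩)
      · exact hU.d_d i hi
      · obtain ⟨-, h2, h3, -, -⟩ := hSK hs
        rw [G.D_r _ s h2, h3]
    · rintro i (hi | ⟨s, hs, rfl⟩)
      · exact hU.m_d i hi
      · obtain ⟨-, h2, -, h4, h5⟩ := hSK hs
        rw [G.D_r _ s h2, G.m_r _ s h4, h5]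
  have hspanN : ∀ {x}, x ∈ Submodule.span ℚ (v '' S) → x ∈ G.sub (U ∪ N) ∧
      x ∈ FreeCGA.gr G.deg (n + 1) := by
    have : Submodule.span ℚ (v '' S) ≤
        Subalgebra.toSubmodule (G.sub (U ∪ N)) ⊓ FreeCGA.gr G.deg (n + 1) := by
      rw [Submodule.span_le]
      rintro _ ⟨s, hs, rfl⟩
      refine ⟨gen_mem_adjoin G.deg (Or.inr ⟨s, hs, rfl⟩), ?_⟩
      have h := gen_mem_gr G.deg (G.r (n + 1) s)
      rwa [G.deg_r] at h
    exact fun {x} hx => this hx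
  have hcomb : ∀ {c}, c ∈ Finsupp.supported ℚ ℚ S →
      Finsupp.linearCombination ℚ v c ∈ Submodule.span ℚ (v '' S) := fun hc =>
    (Finsupp.mem_span_image_iff_linearCombination ℚ).2 ⟨_, hc, rfl⟩
  have hdecomp : ∀ {u}, u ∈ G.sub (U ∪ N) → u ∈ FreeCGA.gr G.deg (n + 1) →
      ∃ y ∈ G.sub U, ∃ c ∈ Finsupp.supported ℚ ℚ S,
        u = y + Finsupp.linearCombination ℚ v c := by
    intro u hu huk
    have h : u ∈ Subalgebra.toSubmodule (G.sub U) ⊔ Submodule.span ℚ (v '' S) := by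
      refine Submodule.span_le.2 ?_ (mem_span_of_mem_adjoin_of_mem_gr G.deg hu huk)
      rintro _ ⟨l, hl, hlk, rfl⟩
      by_cases hlU : ∀ i ∈ l, i ∈ U
      · exact Submodule.mem_sup_left (prod_mem_adjoin G.deg hlU)
      · push Not at hlU
        obtain ⟨i, hi, hiU⟩ := hlU
        have hdi := hN i (hl i hi) hiU
        rcases List.eq_singleton_or_lt_sum (fun j hj => htwo j (hl j hj)) hi with rfl | h
        · refine Submodule.mem_sup_right (Submodule.subset_span ?_)
          obtain ⟨s, hs, rfl⟩ := (hl i hi).resolve_left hiU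
          exact ⟨s, hs, by simp [v]⟩
        · omega
    obtain ⟨y, hy, x, hx, rfl⟩ := Submodule.mem_sup.1 h
    obtain ⟨c, hc, rfl⟩ := (Finsupp.mem_span_image_iff_linearCombination ℚ).1 hx
    exact ⟨y, hy, c, hc, rfl⟩
  have hv : ∀ {c}, c ∈ Finsupp.supported ℚ ℚ S →
      G.D (Finsupp.linearCombination ℚ v c) = (Finsupp.linearCombination ℚ id c).1 ∧
      G.m (Finsupp.linearCombination ℚ v c) = (Finsupp.linearCombination ℚ id c).2 := fun hc =>
    ⟨congrArg Prod.fst (linearCombination_apply_of_supported hSK hc),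
      congrArg Prod.snd (linearCombination_apply_of_supported hSK hc)⟩
  refine ⟨U ∪ N, hUN, hN, hmodel, fun k hk => ?_, fun k hk => ?_⟩
  · rcases Nat.lt_or_eq_of_le hk with hk | rfl
    · intro a ha hda
      obtain ⟨y, hy, h⟩ := hsurj k (by omega) a ha hda
      exact ⟨y, G.sub_mono hUN hy, h⟩
    · intro a ha hda
      -- A cocycle a of A is a relative cocycle with zero first component.
      obtain ⟨c, hc, y, hy, hyk, h1, b, h2⟩ := hspan (0, a)
        ⟨zero_mem _, zero_mem _, map_zero _, ha, by rw [hda, map_zero]⟩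
      rw [Prod.fst_sub, ← (hv hc).1] at h1
      rw [Prod.snd_sub, ← (hv hc).2] at h2
      have hx := hspanN (hcomb hc)
      refine ⟨y + Finsupp.linearCombination ℚ v c, add_mem (G.sub_mono hUN hy) hx.1,
        add_mem hyk hx.2, ?_, b, ?_⟩
      · rw [map_add, ← h1, zero_sub, neg_add_cancel]
      · rw [map_add, add_comm, ← sub_sub, h2, add_sub_cancel_left]
  · by_cases hk1 : k = n + 1
    · subst hk1
      intro u hu huk hdu hmu
      obtain ⟨y, hy, c, hc, rfl⟩ := hdecomp hu huk
      obtain ⟨b, hb⟩ := hmu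
      have hyk : y ∈ FreeCGA.gr G.deg (n + 1) := by
        have := sub_mem huk (hspanN (hcomb hc)).2
        rwa [add_sub_cancel_right] at this
      -- If y + Σ c v is closed with exact image, then the pairs combined by c form the relative
      -- coboundary of -y, so independence leaves no new generators in it.
      have hc0 : c = 0 := by
        refine hind c hc ⟨-y, neg_mem hy, neg_mem hyk, ?_, b, ?_⟩
        · rw [← (hv hc).1, map_neg]
          rw [map_add] at hdu
          exact eq_neg_of_add_eq_zero_right hdu
        · rw [← (hv hc).2, map_neg, ← hb, map_add, neg_add_cancel_left]
      subst hc0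
      rw [map_zero, add_zero] at hdu hb huk ⊢
      obtain ⟨x, hx, rfl⟩ := hinj (n + 1) le_rfl y hy huk hdu ⟨b, hb⟩
      exact ⟨x, G.sub_mono hUN hx, rfl⟩
    · intro u hu huk hdu hmu
      have huU := hlow hk hk1 hu huk
      by_cases hk2 : k = n + 2
      · subst hk2
        obtain ⟨b, hb⟩ := hmu
        have hb' : A.d (GradedAlgebra.proj A.gr (n + 1) b) = G.m u := by
          rw [← A.proj_succ_d, ← hb, A.proj_same (G.m_mem huk)]
        -- A class u that dies in A, together with a homogeneous primitive of its image, is a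
        -- relative cocycle; the new generators make u exact.
        obtain ⟨c, hc, y, hy, hyk, h1, -⟩ := hspan (u, GradedAlgebra.proj A.gr (n + 1) b)
          ⟨huU, huk, hdu, A.proj_mem _ _, hb'⟩
        refine ⟨y + Finsupp.linearCombination ℚ v c,
          add_mem (G.sub_mono hUN hy) (hspanN (hcomb hc)).1, ?_⟩
        rw [map_add, ← h1, (hv hc).1, Prod.fst_sub, sub_add_cancel]
      · obtain ⟨x, hx, rfl⟩ := hinj k (by omega) u huU huk hdu hmu
        exact ⟨x, G.sub_mono hUN hx, rfl⟩

theorem isModel_empty (G : A.GeneratorSupply) : G.IsModel ∅ :=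
  ⟨fun _ h => h.elim, fun _ h => h.elim, fun _ h => h.elim, fun _ h => h.elim⟩

theorem surjectiveAt_empty (G : A.GeneratorSupply) (hA : A.IsCohomologicallyConnected)
    (hA1 : A.cohomology.gr 1 = ⊥) {k : ℕ} (hk : k ≤ 1) : G.SurjectiveAt ∅ k := by
  intro a ha hda
  have hcl : A.toCohomology ⟨a, hda⟩ ∈ A.cohomologyGr k := ⟨⟨a, hda⟩, ha, rfl⟩
  have hd1 : G.D 1 = 0 := by
    simpa using G.leibniz (n := 0) (a := 1) 1 SetLike.GradedOne.one_mem
  interval_cases k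
  · obtain ⟨q, hq⟩ := hA.2 _ hcl
    obtain ⟨c, hc⟩ := toCohomology_eq.1
      (hq.symm.trans (A.toCohomology.commutes q).symm)
    refine ⟨q • 1, Subalgebra.smul_mem _ (one_mem _) q, Submodule.smul_mem _ q
      SetLike.GradedOne.one_mem, by rw [map_smul, hd1, smul_zero], c, ?_⟩
    rw [← hc, map_smul, map_one, ← Algebra.algebraMap_eq_smul_one]
    rfl
  · have h0 : A.toCohomology ⟨a, hda⟩ = 0 := by
      have : A.toCohomology ⟨a, hda⟩ ∈ A.cohomology.gr 1 := hcl
      rw [hA1] at this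
      exact (Submodule.mem_bot ℚ).1 this
    obtain ⟨c, hc⟩ := A.toCohomology_eq_zero.1 h0
    exact ⟨0, zero_mem _, zero_mem _, map_zero _, c, by rw [map_zero, sub_zero]; exact hc⟩

/-- Without generators only the scalars remain, and a nonzero scalar is not exact in A because ℚ →
H⁰(A) is injective. -/
theorem injectiveAt_empty (G : A.GeneratorSupply) (hA : A.IsCohomologicallyConnected) (k : ℕ) :
    G.InjectiveAt ∅ k := by
  rintro y hy hyk hdy ⟨c, hc⟩
  have hyk' := mem_span_of_mem_adjoin_of_mem_gr G.deg hy hyk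
  have hspan : y ∈ Submodule.span ℚ {(1 : FreeCGA G.deg)} := by
    refine Submodule.span_mono ?_ hyk'
    rintro _ ⟨l, hl, -, rfl⟩
    cases l with
    | nil => simp
    | cons i l => exact (hl i (by simp)).elim
  obtain ⟨q, rfl⟩ := Submodule.mem_span_singleton.1 hspan
  refine ⟨0, zero_mem _, ?_⟩
  have hq : q = 0 := by
    refine hA.1 ?_
    rw [map_zero]
    refine (A.toCohomology.commutes q).symm.trans (A.toCohomology_eq_zero.2 ⟨c, ?_⟩)
    rw [← hc, map_smul, map_one, ← Algebra.algebraMap_eq_smul_one]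
    rfl
  rw [hq, zero_smul, map_zero]

theorem exists_model (G : A.GeneratorSupply) (hA : A.IsCohomologicallyConnected)
    (hA1 : A.cohomology.gr 1 = ⊥) :
    ∃ U : Set G.ι, G.IsModel U ∧ (∀ k, G.SurjectiveAt U k) ∧ ∀ k, G.InjectiveAt U k := by
  -- Stage n holds the generators of degree at most n + 1. Stage 0 is empty: H⁰(A) = ℚ and H¹(A) = 0
  -- already give its conditions.
  obtain ⟨s, hs⟩ := exists_seq_of_step
    (fun n (U : Set G.ι) => G.IsModel U ∧ (∀ i ∈ U, G.deg i ≤ n + 1) ∧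
      (∀ k ≤ n + 1, G.SurjectiveAt U k) ∧ ∀ k ≤ n + 2, G.InjectiveAt U k)
    (fun n U U' => U ⊆ U' ∧ ∀ i ∈ U', i ∉ U → G.deg i = n + 2) (y₀ := ∅)
    ⟨G.isModel_empty, fun _ h => h.elim, fun k hk => G.surjectiveAt_empty hA hA1 hk,
      fun k _ => G.injectiveAt_empty hA k⟩ (by
      rintro n U ⟨h1, h2, h3, h4⟩
      obtain ⟨U', hUU', hdeg, h1', h3', h4'⟩ := exists_step (by omega) h1 h2 h3 h4
      refine ⟨U', ⟨hUU', hdeg⟩, h1', fun i hi => ?_, h3', h4'⟩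
      by_cases hiU : i ∈ U
      · have := h2 i hiU
        omega
      · exact (hdeg i hi hiU).le)
  have hmono : Monotone s := monotone_nat_of_le_succ fun n => (hs n).2.1
  have hback : ∀ (m n : ℕ) (i : G.ι), i ∈ s (n + m) → G.deg i ≤ n + 1 → i ∈ s n := by
    intro m n i hi hd
    induction m with
    | zero => exact hi
    | succ m ih =>
      refine ih (by_contra fun h => ?_)
      have := (hs (n + m)).2.2 i hi h
      omega
  have hsub : ∀ n, s n ⊆ ⋃ n, s n := fun n => Set.subset_iUnion s n
  have hlow : ∀ (n : ℕ) (i : G.ι), i ∈ ⋃ n, s n → G.deg i ≤ n + 1 → i ∈ s n := by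
    intro n i hi hd
    obtain ⟨m, hm⟩ := Set.mem_iUnion.1 hi
    exact hback m n i (hmono (Nat.le_add_left m n) hm) hd
  refine ⟨⋃ n, s n, ⟨?_, ?_, ?_, ?_⟩, fun k a ha hda => ?_, fun k y hy hyk hdy hmy => ?_⟩
  · intro i hi
    obtain ⟨m, hm⟩ := Set.mem_iUnion.1 hi
    exact (hs m).1.1.two_le i hm
  · intro i hi
    obtain ⟨m, hm⟩ := Set.mem_iUnion.1 hi
    exact G.sub_mono (U' := {j ∈ ⋃ n, s n | G.deg j < G.deg i})
      (fun j hj => ⟨hsub m hj.1, hj.2⟩) ((hs m).1.1.nilpotent i hm)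
  · intro i hi
    obtain ⟨m, hm⟩ := Set.mem_iUnion.1 hi
    exact (hs m).1.1.d_d i hm
  · intro i hi
    obtain ⟨m, hm⟩ := Set.mem_iUnion.1 hi
    exact (hs m).1.1.m_d i hm
  · obtain ⟨y, hy, h⟩ := (hs k).1.2.2.1 k (by omega) a ha hda
    exact ⟨y, G.sub_mono (hsub k) hy, h⟩
  -- A monomial of degree k uses generators of degree at most k, and all of these are already
  -- present at stage k.
  · have hyk' : y ∈ G.sub (s k) := mem_sub_of_mem_sub (fun l hl hlk i hi =>
      hlow k i (hl i hi) (by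
        have := List.le_sum_of_mem (List.mem_map_of_mem (f := G.deg) hi)
        omega)) hy hyk
    obtain ⟨x, hx, rfl⟩ := (hs k).1.2.2.2 k (by omega) y hyk' hyk hdy hmy
    exact ⟨x, G.sub_mono (hsub k) hx, rfl⟩

end CDGA.GeneratorSupply

/-! ### From a selected set of generators to a minimal Sullivan model. -/

theorem CDGA.Hom.bijective_of_homogeneous {C D : CDGA.{u}} (f : Hom C D)
    (hinj : ∀ n, ∀ x ∈ C.gr n, f.toAlgHom x = 0 → x = 0)
    (hsurj : ∀ n, ∀ y ∈ D.gr n, ∃ x, f.toAlgHom x = y) : Function.Bijective f.toAlgHom := by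
  constructor
  · rw [injective_iff_map_eq_zero]
    intro x hx
    obtain ⟨s, hs⟩ := C.exists_sum_proj x
    rw [← hs]
    refine Finset.sum_eq_zero fun i _ => hinj i _ (C.proj_mem i x) ?_
    rw [f.map_proj, hx, map_zero]
  · intro y
    obtain ⟨s, hs⟩ := D.exists_sum_proj y
    choose x hx using fun i => hsurj i _ (D.proj_mem i y)
    exact ⟨∑ i ∈ s, x i, by rw [map_sum, ← hs]; exact Finset.sum_congr rfl fun i _ => hx i⟩

namespace FreeCGA

variable {ι : Type u} (deg : ι → ℕ) (U : Set ι)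

/-- The free graded-commutative algebra with zero differential. -/
noncomputable def zeroDGA : HomogeneousDGA (FreeCGA deg) where
  gr := gr deg
  one_mem := SetLike.GradedOne.one_mem
  mul_mem ha hb := SetLike.GradedMul.mul_mem ha hb
  mul_comm' := graded_comm deg
  d := 0
  leibniz _ _ := by simp

/-- The inclusion of the free algebra on a subset of the generators. -/
noncomputable def incl : FreeCGA (fun i : U => deg i) →ₐ[ℚ] FreeCGA deg :=
  lift _ (fun i => gen deg i) fun i j => gen_mul_gen deg i j

theorem incl_gen (i : U) : incl deg U (gen _ i) = gen deg i := lift_gen _ _ _ i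

open Classical in
/-- The projection to the free algebra on a subset of the generators. -/
noncomputable def restrict : FreeCGA deg →ₐ[ℚ] FreeCGA (fun i : U => deg i) :=
  lift _ (fun i => if h : i ∈ U then gen (fun i : U => deg i) ⟨i, h⟩ else 0) (by
    intro i j
    by_cases hi : i ∈ U
    · by_cases hj : j ∈ U
      · simpa [hi, hj] using gen_mul_gen (fun i : U => deg i) ⟨i, hi⟩ ⟨j, hj⟩
      · simp [hj]
    · simp [hi])

theorem restrict_gen_of_mem {i : ι} (hi : i ∈ U) :
    restrict deg U (gen deg i) = gen (fun i : U => deg i) ⟨i, hi⟩ := by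
  rw [restrict, lift_gen, dif_pos hi]

theorem restrict_gen_of_notMem {i : ι} (hi : i ∉ U) : restrict deg U (gen deg i) = 0 := by
  rw [restrict, lift_gen, dif_neg hi]

theorem restrict_incl (x : FreeCGA (fun i : U => deg i)) :
    restrict deg U (incl deg U x) = x :=
  algHom_eq_of_mem_adjoin (φ := (restrict deg U).comp (incl deg U)) (ψ := AlgHom.id ℚ _)
    (fun i _ => by simp [incl_gen, restrict_gen_of_mem deg U i.2]) (mem_adjoin_univ _ x)

/-- With `restrict_incl`, this identifies the free algebra on U with the subalgebra generated by U,
so that D can be transported whenever it preserves that subalgebra. -/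
theorem incl_restrict {x : FreeCGA deg} (hx : x ∈ Algebra.adjoin ℚ (gen deg '' U)) :
    incl deg U (restrict deg U x) = x :=
  algHom_eq_of_mem_adjoin (φ := (incl deg U).comp (restrict deg U)) (ψ := AlgHom.id ℚ _)
    (fun i hi => by simp [incl_gen, restrict_gen_of_mem deg U hi]) hx

theorem incl_mem_adjoin (x : FreeCGA (fun i : U => deg i)) :
    incl deg U x ∈ Algebra.adjoin ℚ (gen deg '' U) := by
  have h : incl deg U x ∈ (Algebra.adjoin ℚ (gen (fun i : U => deg i) '' Set.univ)).map
      (incl deg U) := ⟨x, mem_adjoin_univ _ x, rfl⟩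
  rw [AlgHom.map_adjoin] at h
  refine Algebra.adjoin_mono ?_ h
  rintro _ ⟨_, ⟨i, -, rfl⟩, rfl⟩
  exact ⟨i, i.2, (incl_gen deg U i).symm⟩

theorem incl_mem_gr {n : ℕ} {x : FreeCGA (fun i : U => deg i)} (hx : x ∈ gr _ n) :
    incl deg U x ∈ gr deg n :=
  map_mem_gr (zeroDGA deg) _ (fun i => by rw [incl_gen]; exact gen_mem_gr deg i) hx

theorem restrict_mem_gr {n : ℕ} {x : FreeCGA deg} (hx : x ∈ gr deg n) :
    restrict deg U x ∈ gr (fun i : U => deg i) n :=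
  map_mem_gr (zeroDGA (fun i : U => deg i)) _ (fun i => by
    by_cases hi : i ∈ U
    · rw [restrict_gen_of_mem deg U hi]; exact gen_mem_gr (fun i : U => deg i) ⟨i, hi⟩
    · rw [restrict_gen_of_notMem deg U hi]; exact zero_mem _) hx

end FreeCGA

/-- A Sullivan algebra filtered by the degrees of its generators is minimal. -/
theorem SullivanAlgebra.isMinimal_of_level_eq_deg (M : SullivanAlgebra.{u})
    (hlevel : M.level = M.deg) : M.IsMinimal := by
  intro i
  have h := FreeCGA.mem_span_of_mem_adjoin_of_mem_gr M.deg (M.nilpotent i)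
    (M.d_mem (FreeCGA.gen_mem_gr M.deg i))
  rw [hlevel] at h
  let Q : Submodule ℚ (FreeCGA M.deg) := M.toCDGA.positivePart
  change M.d (FreeCGA.gen M.deg i) ∈ Q * Q
  refine Submodule.span_le.2 ?_ h
  -- Each monomial has degree deg i + 1 but factors of degree below deg i, hence has at least two
  -- factors.
  rintro _ ⟨l, hl, hsum, rfl⟩
  have hpos : ∀ {n : ℕ} {x : FreeCGA M.deg}, 1 ≤ n → x ∈ FreeCGA.gr M.deg n →
      x ∈ Q := by
    intro n x hn hx
    obtain ⟨n, rfl⟩ := Nat.exists_eq_add_of_le' hn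
    exact le_iSup (fun n => M.toCDGA.gr (n + 1)) n hx
  cases l with
  | nil => simp at hsum
  | cons j l =>
    have hj : M.deg j < M.deg i := hl j (by simp)
    rw [List.map_cons, List.sum_cons] at hsum
    rw [List.map_cons, List.prod_cons]
    exact Submodule.mul_mem_mul (hpos (M.deg_pos j) (FreeCGA.gen_mem_gr M.deg j))
      (hpos (by omega) (FreeCGA.prod_mem_gr M.deg l))

namespace CDGA.GeneratorSupply

open FreeCGA

variable {A : CDGA.{u}} {G : A.GeneratorSupply} {U : Set G.ι}

/-- The Sullivan algebra on the set `U` of generators. -/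
noncomputable def IsModel.sullivan (hU : G.IsModel U) : SullivanAlgebra.{u} where
  ι := U
  deg i := G.deg i
  deg_pos i := (by omega : 1 ≤ 2).trans (hU.two_le i i.2)
  d := (restrict G.deg U).toLinearMap.comp (G.D.comp (incl G.deg U).toLinearMap)
  d_mem ha := restrict_mem_gr G.deg U (G.d_mem (incl_mem_gr G.deg U ha))
  d_d a := by
    change restrict G.deg U (G.D (incl G.deg U (restrict G.deg U (G.D (incl G.deg U a))))) = 0
    rw [incl_restrict G.deg U (hU.D_mem (incl_mem_adjoin G.deg U a)),
      hU.D_D (incl_mem_adjoin G.deg U a), map_zero]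
  leibniz {n a} b ha := by
    change restrict G.deg U (G.D (incl G.deg U (a * b))) =
      restrict G.deg U (G.D (incl G.deg U a)) * b +
        (-1 : ℚ) ^ n • (a * restrict G.deg U (G.D (incl G.deg U b)))
    rw [map_mul, G.leibniz _ (incl_mem_gr G.deg U ha), map_add, map_smul, map_mul, map_mul,
      restrict_incl, restrict_incl]
  level i := G.deg i
  nilpotent i := by
    have h : restrict G.deg U (G.D (gen G.deg i)) ∈
        (G.sub {j ∈ U | G.deg j < G.deg i}).map (restrict G.deg U) :=
      ⟨_, hU.nilpotent i i.2, rfl⟩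
    rw [AlgHom.map_adjoin] at h
    change restrict G.deg U (G.D (incl G.deg U (gen _ i))) ∈ _
    rw [incl_gen]
    refine Algebra.adjoin_mono ?_ h
    rintro _ ⟨_, ⟨j, ⟨hj, hji⟩, rfl⟩, rfl⟩
    exact ⟨⟨j, hj⟩, hji, (restrict_gen_of_mem G.deg U hj).symm⟩

theorem IsModel.incl_d (hU : G.IsModel U) (x : FreeCGA (fun i : U => G.deg i)) :
    incl G.deg U (hU.sullivan.d x) = G.D (incl G.deg U x) :=
  incl_restrict G.deg U (hU.D_mem (incl_mem_adjoin G.deg U x))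

/-- The morphism from the Sullivan algebra on `U` to `A`. -/
noncomputable def IsModel.toHom (hU : G.IsModel U) : Hom hU.sullivan.toCDGA A where
  toAlgHom := G.m.comp (incl G.deg U)
  map_gr ha := G.m_mem (incl_mem_gr G.deg U ha)
  map_d a := (congrArg G.m (hU.incl_d a)).trans (hU.m_D (incl_mem_adjoin G.deg U a))

theorem IsModel.isQuasiIso_toHom (hU : G.IsModel U) (hsurj : ∀ k, G.SurjectiveAt U k)
    (hinj : ∀ k, G.InjectiveAt U k) : hU.toHom.IsQuasiIso := by
  refine Hom.bijective_of_homogeneous _ ?_ ?_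
  · rintro n _ ⟨⟨z, hdz⟩, hz, rfl⟩ h
    obtain ⟨c, hc⟩ := A.toCohomology_eq_zero.1 h
    have hdz' : hU.sullivan.d z = 0 := hdz
    obtain ⟨x, hx, hxz⟩ := hinj n (incl G.deg U z) (incl_mem_adjoin G.deg U z)
      (incl_mem_gr G.deg U hz)
      ((hU.incl_d z).symm.trans ((congrArg (incl G.deg U) hdz').trans (map_zero _))) ⟨c, hc⟩
    refine hU.sullivan.toCDGA.toCohomology_eq_zero.2 ⟨restrict G.deg U x, ?_⟩
    change z = restrict G.deg U (G.D (incl G.deg U (restrict G.deg U x)))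
    rw [incl_restrict G.deg U hx, ← hxz]
    exact (restrict_incl G.deg U z).symm
  · rintro n _ ⟨⟨a, hda⟩, ha, rfl⟩
    obtain ⟨y, hy, hyn, hdy, c, hc⟩ := hsurj n a ha hda
    have hdy' : hU.sullivan.toCDGA.d (restrict G.deg U y) = 0 := by
      change restrict G.deg U (G.D (incl G.deg U (restrict G.deg U y))) = 0
      rw [incl_restrict G.deg U hy, hdy, map_zero]
    refine ⟨hU.sullivan.toCDGA.toCohomology ⟨restrict G.deg U y, hdy'⟩, ?_⟩
    symm
    refine toCohomology_eq.2 ⟨c, ?_⟩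
    change a - G.m (incl G.deg U (restrict G.deg U y)) = A.d c
    rw [incl_restrict G.deg U hy, hc]

end CDGA.GeneratorSupply

/-- A CDGA with `H⁰ = ℚ` and `H¹ = 0` has a minimal Sullivan model. -/
theorem CDGA.exists_isMinimalModel (A : CDGA.{u}) (hA : A.IsCohomologicallyConnected)
    (hA1 : A.cohomology.gr 1 = ⊥) : ∃ M : SullivanAlgebra.{u}, M.IsMinimalModel A := by
  obtain ⟨G⟩ := A.nonempty_generatorSupply
  obtain ⟨U, hU, hsurj, hinj⟩ := G.exists_model hA hA1
  exact ⟨hU.sullivan, hU.sullivan.isMinimal_of_level_eq_deg rfl, hU.toHom,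
    hU.isQuasiIso_toHom hsurj hinj⟩

theorem proposition2p1 (A B : CDGA.{u})
    (hA : A.IsCohomologicallyConnected) (hB : B.IsCohomologicallyConnected)
    (hA1 : A.cohomology.gr 1 = ⊥)
    (f : CDGA.Hom A B) (g : CDGA.Hom B A) (hgf : g.comp f = CDGA.Hom.id A)
    (hformal : B.IsFormal) : A.IsFormal := by
  obtain ⟨M, hM⟩ := A.exists_isMinimalModel hA hA1
  exact hformal.of_retract f g hgf hM
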